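/- Let $\mathcal L_\in$ be the first-order language with equality and the single binary relation symbol $\in$, and let $\mathsf{KP}\omega$ be Kripke–Platek set theory with infinity, as an $\mathcal L_\in$-theory: extensionality, pairing, union, infinity, foundation for all formulas, and separation and collection for $\Delta_0$ formulas. Here $\vdash$ denotes derivability in classical first-order logic with equality. Inside $\mathsf{KP}\omega$, let $\mathcal L_\infty$ be the usual set-theoretic coding of the first-order language extending $\mathcal L_\in$ by a constant $\dot x$ for each set $x$; its formulas are coded by sets, with variables indexed by $\omega$. For an $\mathcal L_\in$-formula $\tau(x)$ let $\mathrm{Prov}_\tau(y)$ be the $\mathcal L_\in$-formula saying that there is a finite sequence ending with $y$, each member of which is a logical axiom of a standard Hilbert calculus for classical first-order logic with equality in the language $\mathcal L_\infty$, or satisfies $\tau$, or follows from earlier members by modus ponens or generalization. For an $\mathcal L_\in$-formula $\varphi(x)$, $\ulcorner\varphi(\dot x)\urcorner$ denotes the code of the result of replacing the free variable $x$ in $\varphi$ by the constant $\dot x$. Put $$\mathrm{Rfn}(\tau)=\{\mathrm{Prov}_\tau(\ulcorner\sigma\urcorner)\to\sigma \;:\; \sigma \text{ an } \mathcal L_\in\text{-sentence}\},$$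 $$\mathrm{RFN}^\infty(\tau)=\{\forall x\,(\mathrm{Prov}_\tau(\ulcorner\varphi(\dot x)\urcorner)\to\varphi(x)) \;:\; \varphi\in\mathcal L_\in \text{ with at most } x \text{ free}\}.$$ Let $T\supseteq\mathsf{KP}\omega$ be an $\mathcal L_\in$-theory (that is, $T$ proves every axiom of $\mathsf{KP}\omega$) and let $\tau(x)$ be an $\mathcal L_\in$-formula presenting $T$ inside $\mathsf{KP}\omega$ as an $\mathcal L_\infty$-theory whose axioms contain none of the constants $\dot x$. That is, $\mathsf{KP}\omega\vdash\tau(\ulcorner\sigma\urcorner)$ for every axiom $\sigma$ of $T$, and $\mathsf{KP}\omega\vdash\forall x\,(\tau(x)\to x \text{ is a formula of } \mathcal L_\in)$. Then: 1. For every $\mathcal L_\in$-formula $\varphi$ with at most the variable $x$ free, $$\mathsf{KP}\omega\vdash \big(\forall x\,\mathrm{Prov}_\tau(\ulcorner\varphi(\dot x)\urcorner)\big)\to \mathrm{Prov}_\tau(\ulcorner\forall x\,\varphi\urcorner).$$ 2. Uniform and local reflection for $T$ coincide: $\mathsf{KP}\omega+\mathrm{RFN}^\infty(\tau)$ and $\mathsf{KP}\omega+\mathrm{Rfn}(\tau)$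 prove the same $\mathcal L_\in$-sentences, and $T+\mathrm{RFN}^\infty(\tau)$ and $T+\mathrm{Rfn}(\tau)$ prove the same $\mathcal L_\in$-sentences. -/

import Mathlib

open FirstOrder FirstOrder.Language

/-! ## First-order derivability over Mathlib's syntax -/

namespace FODeriv

/-- `φ(t)`: the term `t` is substituted for the last variable `&0` of `φ`. -/
def inst {L : Language} (φ : L.BoundedFormula ℕ 1) (t : L.Term ℕ) : L.Formula ℕ :=
  BoundedFormula.subst φ.toFormula (Sum.elim Term.var (fun _ => t))

/-- Classical natural deduction with equality. The free variables are indexed by `ℕ`; bound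
variables are kept apart from them, so that substitution never captures. -/
inductive Derives {L : Language} : Set (L.Formula ℕ) → L.Formula ℕ → Prop
  | ax {Γ : Set (L.Formula ℕ)} {φ : L.Formula ℕ} : φ ∈ Γ → Derives Γ φ
  | impI {Γ : Set (L.Formula ℕ)} {φ ψ : L.Formula ℕ} :
      Derives (insert φ Γ) ψ → Derives Γ (φ.imp ψ)
  | impE {Γ : Set (L.Formula ℕ)} {φ ψ : L.Formula ℕ} :
      Derives Γ (φ.imp ψ) → Derives Γ φ → Derives Γ ψ
  | raa {Γ : Set (L.Formula ℕ)} {φ : L.Formula ℕ} :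
      Derives (insert (BoundedFormula.not φ) Γ) BoundedFormula.falsum → Derives Γ φ
  | allI {Γ : Set (L.Formula ℕ)} {φ : L.BoundedFormula ℕ 1} (x : ℕ) :
      (∀ ψ ∈ Γ, x ∉ BoundedFormula.freeVarFinset ψ) → x ∉ φ.freeVarFinset →
      Derives Γ (inst φ (Term.var x)) → Derives Γ φ.all
  | allE {Γ : Set (L.Formula ℕ)} {φ : L.BoundedFormula ℕ 1} (t : L.Term ℕ) :
      Derives Γ φ.all → Derives Γ (inst φ t)
  | eqRefl {Γ : Set (L.Formula ℕ)} (t : L.Term ℕ) : Derives Γ (t.equal t)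
  | eqSubst {Γ : Set (L.Formula ℕ)} {φ : L.BoundedFormula ℕ 1} (s t : L.Term ℕ) :
      Derives Γ (s.equal t) → Derives Γ (inst φ s) → Derives Γ (inst φ t)

/-- A sentence, read as a formula with free variables indexed by `ℕ` (none of them occurs). -/
def lift {L : Language} (σ : L.Sentence) : L.Formula ℕ :=
  Formula.relabel (fun e : Empty => e.elim) σ

/-- `Proves T σ`: the sentence `σ` is derivable from the axioms `T`. -/
def Proves {L : Language} (T : L.Theory) (σ : L.Sentence) : Prop :=
  Derives (lift '' T) (lift σ)

end FODeriv

/-! ## The language of set theory -/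

namespace SetRefl

inductive MemRel : ℕ → Type
  | mem : MemRel 2

/-- The language `L_∈`: one binary relation symbol, no function symbols (equality is logical). -/
def Lin : Language := ⟨fun _ => Empty, MemRel⟩

/-- `F n`: formulas of `L_∈` whose free variables are among `&0, …, &(n-1)`. A quantifier on a
formula of `F (n+1)` binds `&n`. -/
abbrev F (n : ℕ) := Lin.BoundedFormula Empty n

/-- A variable in scope remains in scope below a quantifier. -/
instance coeVar (n : ℕ) : Coe (Fin n) (Fin (n + 1)) := ⟨Fin.castSucc⟩

def eqF {n : ℕ} (x y : Fin n) : F n := Term.bdEqual (&x) (&y)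

def memF {n : ℕ} (x y : Fin n) : F n := Relations.boundedFormula₂ (L := Lin) MemRel.mem (&x) (&y)

/-- Quantifiers; the bound variable is passed to the body. -/
def allF {n : ℕ} (f : Fin (n + 1) → F (n + 1)) : F n := (f (Fin.last n)).all

def exF {n : ℕ} (f : Fin (n + 1) → F (n + 1)) : F n := (f (Fin.last n)).ex

/-- `∀ z ∈ x, f z`. -/
def ballF {n : ℕ} (x : Fin n) (f : Fin (n + 1) → F (n + 1)) : F n :=
  allF fun z => memF z x ⟹ f z

/-- `∃ z ∈ x, f z`. -/
def bexF {n : ℕ} (x : Fin n) (f : Fin (n + 1) → F (n + 1)) : F n :=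
  exF fun z => memF z x ⊓ f z

/-- `φ(v 0, …, v (k-1))`, as a formula in the variables of `F n`. -/
def app {k n : ℕ} (φ : F k) (v : Fin k → Fin n) : F n :=
  BoundedFormula.relabel (k := 0)
    (Sum.elim (fun e : Empty => e.elim) (fun i => Sum.inr (v i)) : Empty ⊕ Fin k → Empty ⊕ Fin n)
    φ.toFormula

/-! ## The theory `KPω` -/

/-- `Δ₀` formulas. -/
inductive IsDelta0 : ∀ {n : ℕ}, F n → Prop
  | falsum {n : ℕ} : IsDelta0 (BoundedFormula.falsum : F n)
  | eq {n : ℕ} (x y : Fin n) : IsDelta0 (eqF x y)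
  | mem {n : ℕ} (x y : Fin n) : IsDelta0 (memF x y)
  | imp {n : ℕ} {φ ψ : F n} : IsDelta0 φ → IsDelta0 ψ → IsDelta0 (φ ⟹ ψ)
  | ball {n : ℕ} (x : Fin n) {φ : F (n + 1)} : IsDelta0 φ → IsDelta0 (ballF x fun _ => φ)
  | bex {n : ℕ} (x : Fin n) {φ : F (n + 1)} : IsDelta0 φ → IsDelta0 (bexF x fun _ => φ)

/-- `z` is empty. -/
def isEmpty {n : ℕ} (z : Fin n) : F n := allF fun w => ∼(memF w z)

/-- `y = x ∪ {x}`. -/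
def isSucc {n : ℕ} (x y : Fin n) : F n := allF fun z => memF z y ⇔ (memF z x ⊔ eqF z x)

def extensionality : Lin.Sentence :=
  allF (n := 0) fun x => allF fun y => (allF fun z => memF z x ⇔ memF z y) ⟹ eqF x y

def pairing : Lin.Sentence :=
  allF (n := 0) fun x => allF fun y => exF fun a => memF x a ⊓ memF y a

def union : Lin.Sentence :=
  allF (n := 0) fun a => exF fun b => ballF a fun y => ballF y fun x => memF x b

def infinity : Lin.Sentence :=
  exF (n := 0) fun w => (bexF w fun z => isEmpty z) ⊓
    ballF w fun x => bexF w fun y => isSucc x y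

/-- `∃ x, φ(p, x) → ∃ x, φ(p, x) ∧ ∀ y ∈ x, ¬ φ(p, y)`, with parameters `p`. -/
def foundation {n : ℕ} (φ : F (n + 1)) : Lin.Sentence :=
  BoundedFormula.alls <|
    (exF fun x => app φ (Fin.snoc (fun i : Fin n => (i : Fin (n + 1))) x)) ⟹
      exF fun x => app φ (Fin.snoc (fun i : Fin n => (i : Fin (n + 1))) x) ⊓
        ballF x fun y => ∼(app φ (Fin.snoc (fun i : Fin n => (i : Fin (n + 1 + 1))) y))

/-- `∀ a, ∃ b, ∀ x, x ∈ b ↔ x ∈ a ∧ φ(p, x)`, with parameters `p`. -/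
def separation {n : ℕ} (φ : F (n + 1)) : Lin.Sentence :=
  BoundedFormula.alls <| allF (n := n) fun a => exF fun b => allF fun x =>
    memF x b ⇔ (memF x a ⊓
      app φ (Fin.snoc (fun i : Fin n => (i : Fin (n + 1 + 1 + 1))) x))

/-- `∀ a, (∀ x ∈ a, ∃ y, φ(p, x, y)) → ∃ b, ∀ x ∈ a, ∃ y ∈ b, φ(p, x, y)`, with parameters `p`. -/
def collection {n : ℕ} (φ : F (n + 2)) : Lin.Sentence :=
  BoundedFormula.alls <| allF (n := n) fun a =>
    (ballF a fun x => exF fun y =>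
      app φ (Fin.snoc (Fin.snoc (fun i : Fin n => (i : Fin (n + 1 + 1 + 1))) (x : Fin _)) y)) ⟹
    exF fun b => ballF a fun x => bexF b fun y =>
      app φ (Fin.snoc (Fin.snoc (fun i : Fin n => (i : Fin (n + 1 + 1 + 1 + 1))) (x : Fin _)) y)

/-- Kripke–Platek set theory with infinity: extensionality, pairing, union, infinity, foundation
for all formulas, and separation and collection for `Δ₀` formulas. -/
inductive KPw : Lin.Sentence → Prop
  | extensionality : KPw extensionality
  | pairing : KPw pairing
  | union : KPw union
  | infinity : KPw infinity
  | foundation {n : ℕ} (φ : F (n + 1)) : KPw (foundation φ)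
  | separation {n : ℕ} {φ : F (n + 1)} : IsDelta0 φ → KPw (separation φ)
  | collection {n : ℕ} {φ : F (n + 2)} : IsDelta0 φ → KPw (collection φ)

def KPomega : Lin.Theory := {σ | KPw σ}

/-! ## Basic set-theoretic formulas -/

/-- `z = {x, y}`. -/
def isUpair {n : ℕ} (x y z : Fin n) : F n := allF fun w => memF w z ⇔ (eqF w x ⊔ eqF w y)

/-- `p = ⟨x, y⟩ = {{x}, {x, y}}`. -/
def isPair {n : ℕ} (x y p : Fin n) : F n :=
  allF fun z => memF z p ⇔ (isUpair (x : Fin _) x z ⊔ isUpair (x : Fin _) y z)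

/-- `⟨x, y⟩ ∈ f`. -/
def pairMem {n : ℕ} (x y f : Fin n) : F n := exF fun p => isPair (x : Fin _) y p ⊓ memF p f

/-- `x` is a transitive set. -/
def isTrans {n : ℕ} (x : Fin n) : F n := ballF x fun y => ballF y fun z => memF z x

def isZeroOrSucc {n : ℕ} (x : Fin n) : F n := isEmpty x ⊔ exF fun y => isSucc y x

/-- `x ∈ ω`: `x` is an ordinal, and `x` and all its elements are zero or successors. -/
def isNat {n : ℕ} (x : Fin n) : F n :=
  isTrans x ⊓ (ballF x fun y => isTrans y) ⊓ isZeroOrSucc x ⊓ ballF x fun y => isZeroOrSucc y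

/-- `x` is the numeral of `k`, a von Neumann natural number. -/
def isNumeral : ℕ → ∀ {n : ℕ}, Fin n → F n
  | 0, _, x => isEmpty x
  | k + 1, _, x => exF fun y => isNumeral k y ⊓ isSucc y x

/-- `y = ⟨k, a⟩`. -/
def isTagged {n : ℕ} (k : ℕ) (a y : Fin n) : F n :=
  exF fun m => isNumeral k m ⊓ isPair m (a : Fin _) y

/-- `y = ⟨k, ⟨a, b⟩⟩`. -/
def isTagged₂ {n : ℕ} (k : ℕ) (a b y : Fin n) : F n :=
  exF fun p => isPair (a : Fin _) b p ⊓ isTagged k p y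

/-! ## The language `L_∞` with a constant for each set, formalized in `L_∈`

The variable `v_i` is coded by `⟨0, i⟩` and the constant for the set `x` by `⟨1, x⟩`. The formulas
`⊥`, `s = t`, `s ∈ t`, `a → b`, `∀ v a` are coded by `⟨0, ∅⟩`, `⟨1, ⟨s, t⟩⟩`, `⟨2, ⟨s, t⟩⟩`,
`⟨3, ⟨a, b⟩⟩` and `⟨4, ⟨v, a⟩⟩`. -/

def isVar {n : ℕ} (y : Fin n) : F n := exF fun i => isNat i ⊓ isTagged 0 i y

/-- `y` is the constant for the set `x`. -/
def isConstOf {n : ℕ} (x y : Fin n) : F n := isTagged 1 x y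

def isTerm {n : ℕ} (y : Fin n) : F n := isVar y ⊔ exF fun x => isConstOf x y

def isBot {n : ℕ} (y : Fin n) : F n := exF fun z => isEmpty z ⊓ isTagged 0 z y
def isEq {n : ℕ} (s t y : Fin n) : F n := isTagged₂ 1 s t y
def isMem {n : ℕ} (s t y : Fin n) : F n := isTagged₂ 2 s t y
def isImp {n : ℕ} (a b y : Fin n) : F n := isTagged₂ 3 a b y
def isAll {n : ℕ} (v a y : Fin n) : F n := isTagged₂ 4 v a y

/-- `y` is a formula whose terms satisfy `P`: it belongs to a set each of whose members is atomic
or built from members. (Membership is well founded, so this is the usual inductive notion.) -/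
def isFormOver (P : ∀ {m : ℕ}, Fin m → F m) {n : ℕ} (y : Fin n) : F n :=
  exF fun w => memF (y : Fin _) w ⊓ ballF w fun a =>
    isBot a ⊔
    (exF fun s => exF fun t => P (s : Fin _) ⊓ P t ⊓
      (isEq (s : Fin _) t a ⊔ isMem (s : Fin _) t a)) ⊔
    (bexF w fun b => bexF w fun c => isImp b c a) ⊔
    (exF fun v => bexF w fun b => isVar (v : Fin _) ⊓ isAll v b a)

/-- `y` is a formula of `L_∞`. -/
def isForm {n : ℕ} (y : Fin n) : F n := isFormOver (fun t => isTerm t) y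

/-- `y` is a formula of `L_∈`, that is, a formula of `L_∞` without constants. -/
def isFormIn {n : ℕ} (y : Fin n) : F n := isFormOver (fun t => isVar t) y

/-- The variable `v` does not occur free in the formula `a`. -/
def notFree {n : ℕ} (v a : Fin n) : F n :=
  exF fun w => memF (a : Fin _) w ⊓ ballF w fun b =>
    isBot b ⊔
    (exF fun s => exF fun t => ∼(eqF (s : Fin _) v) ⊓ ∼(eqF t v) ⊓
      (isEq (s : Fin _) t b ⊔ isMem (s : Fin _) t b)) ⊔
    (bexF w fun c => bexF w fun d => isImp c d b) ⊔
    (exF fun u => exF fun c => isAll (u : Fin _) c b ⊓ (eqF (u : Fin _) v ⊔ memF c w))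

/-- `s'` is the result of substituting the term `t` for `v` in the term `s`. -/
def substTerm {n : ℕ} (v t s s' : Fin n) : F n :=
  (eqF s v ⊓ eqF s' t) ⊔ (∼(eqF s v) ⊓ eqF s' s)

/-- The term `t` is free for `v` in the formula `a`, and `b` is the result of substituting `t` for
the free occurrences of `v` in `a`. -/
def isSubst {n : ℕ} (v t a b : Fin n) : F n :=
  exF fun w => pairMem (a : Fin _) b w ⊓ ballF w fun p => exF fun c => exF fun d =>
    isPair (c : Fin _) d p ⊓
    ((isBot (c : Fin _) ⊓ isBot d) ⊔
    (exF fun s => exF fun r => exF fun s' => exF fun r' =>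
      substTerm (v : Fin _) t s s' ⊓ substTerm (v : Fin _) t r r' ⊓
      ((isEq (s : Fin _) r c ⊓ isEq (s' : Fin _) r' d) ⊔
        (isMem (s : Fin _) r c ⊓ isMem (s' : Fin _) r' d))) ⊔
    (exF fun c₁ => exF fun c₂ => exF fun d₁ => exF fun d₂ =>
      isImp (c₁ : Fin _) c₂ c ⊓ isImp (d₁ : Fin _) d₂ d ⊓
      pairMem (c₁ : Fin _) d₁ w ⊓ pairMem (c₂ : Fin _) d₂ w) ⊔
    (exF fun c₁ => isAll (v : Fin _) c₁ c ⊓ eqF (d : Fin _) c) ⊔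
    (exF fun u => exF fun c₁ => exF fun d₁ =>
      ∼(eqF (u : Fin _) v) ⊓ isAll (u : Fin _) c₁ c ⊓ isAll (u : Fin _) d₁ d ⊓
      pairMem (c₁ : Fin _) d₁ w ⊓ (∼(eqF (u : Fin _) t) ⊔ notFree (v : Fin _) c₁)))

/-! ## Provability in a theory presented by a formula -/

/-- `a → (b → a)` -/
def axK {n : ℕ} (y : Fin n) : F n :=
  exF fun a => exF fun b => exF fun p => isForm (a : Fin _) ⊓ isForm (b : Fin _) ⊓
    isImp (b : Fin _) a p ⊓ isImp (a : Fin _) p y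

/-- `(a → (b → c)) → ((a → b) → (a → c))` -/
def axS {n : ℕ} (y : Fin n) : F n :=
  exF fun a => exF fun b => exF fun c => exF fun bc => exF fun abc => exF fun ab => exF fun ac =>
    exF fun q => isForm (a : Fin _) ⊓ isForm (b : Fin _) ⊓ isForm (c : Fin _) ⊓
      isImp (b : Fin _) c bc ⊓ isImp (a : Fin _) bc abc ⊓ isImp (a : Fin _) b ab ⊓
      isImp (a : Fin _) c ac ⊓ isImp (ab : Fin _) ac q ⊓ isImp (abc : Fin _) q y

/-- `((a → ⊥) → ⊥) → a` -/
def axDN {n : ℕ} (y : Fin n) : F n :=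
  exF fun a => exF fun f => exF fun p => exF fun q => isForm (a : Fin _) ⊓ isBot (f : Fin _) ⊓
    isImp (a : Fin _) f p ⊓ isImp (p : Fin _) f q ⊓ isImp (q : Fin _) a y

/-- `∀ v a → a(t/v)`, where `t` is free for `v` in `a` -/
def axInst {n : ℕ} (y : Fin n) : F n :=
  exF fun v => exF fun t => exF fun a => exF fun b => exF fun p =>
    isVar (v : Fin _) ⊓ isTerm (t : Fin _) ⊓ isForm (a : Fin _) ⊓ isSubst (v : Fin _) t a b ⊓
      isAll (v : Fin _) a p ⊓ isImp (p : Fin _) b y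

/-- `∀ v (a → b) → (a → ∀ v b)`, where `v` is not free in `a` -/
def axDist {n : ℕ} (y : Fin n) : F n :=
  exF fun v => exF fun a => exF fun b => exF fun ab => exF fun p => exF fun r => exF fun q =>
    isVar (v : Fin _) ⊓ isForm (a : Fin _) ⊓ isForm (b : Fin _) ⊓ notFree (v : Fin _) a ⊓
      isImp (a : Fin _) b ab ⊓ isAll (v : Fin _) ab p ⊓ isAll (v : Fin _) b r ⊓
      isImp (a : Fin _) r q ⊓ isImp (p : Fin _) q y

/-- `t = t` -/
def axRefl {n : ℕ} (y : Fin n) : F n := exF fun t => isTerm t ⊓ isEq t (t : Fin _) y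

/-- `s = t → (s = u → t = u)`, `s = t → (s ∈ u → t ∈ u)`, `s = t → (u ∈ s → u ∈ t)` -/
def axLeib {n : ℕ} (y : Fin n) : F n :=
  exF fun s => exF fun t => exF fun u => exF fun e => exF fun a => exF fun b => exF fun p =>
    isTerm (s : Fin _) ⊓ isTerm (t : Fin _) ⊓ isTerm (u : Fin _) ⊓ isEq (s : Fin _) t e ⊓
      ((isEq (s : Fin _) u a ⊓ isEq (t : Fin _) u b) ⊔
        (isMem (s : Fin _) u a ⊓ isMem (t : Fin _) u b) ⊔
        (isMem (u : Fin _) s a ⊓ isMem (u : Fin _) t b)) ⊓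
      isImp (a : Fin _) b p ⊓ isImp (e : Fin _) p y

/-- `y` is a logical axiom of `L_∞`. -/
def isLogicalAxiom {n : ℕ} (y : Fin n) : F n :=
  axK y ⊔ axS y ⊔ axDN y ⊔ axInst y ⊔ axDist y ⊔ axRefl y ⊔ axLeib y

/-- `f` is a function with domain `m`. -/
def isFunOn {n : ℕ} (f m : Fin n) : F n :=
  (ballF f fun p => bexF m fun i => exF fun a => isPair (i : Fin _) a p) ⊓
  (ballF m fun i => exF fun a => pairMem (i : Fin _) a f) ⊓
  (ballF m fun i => allF fun a => allF fun b =>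
    pairMem (i : Fin _) a f ⟹ pairMem (i : Fin _) b f ⟹ eqF (a : Fin _) b)

/-- The formula `a` may stand as line `i` of the derivation `f`: it is a logical axiom, an axiom
of `τ`, or it follows from earlier lines by modus ponens or generalization. -/
def isLine (τ : F 1) {n : ℕ} (f i a : Fin n) : F n :=
  isLogicalAxiom a ⊔ app τ ![a] ⊔
  (bexF i fun j => bexF i fun k => exF fun b => exF fun c =>
    pairMem (j : Fin _) b f ⊓ pairMem (k : Fin _) c f ⊓ isImp (b : Fin _) a c) ⊔
  (bexF i fun j => exF fun v => exF fun b =>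
    pairMem (j : Fin _) b f ⊓ isVar (v : Fin _) ⊓ isAll (v : Fin _) b a)

/-- `Proof_τ(f, y)`: `f` is a nonempty finite sequence of lines whose last member is `y`. -/
def isProof (τ : F 1) {n : ℕ} (f y : Fin n) : F n :=
  exF fun l => exF fun m => isNat (l : Fin _) ⊓ isSucc (l : Fin _) m ⊓ isFunOn (f : Fin _) m ⊓
    (ballF m fun i => allF fun a => pairMem (i : Fin _) a f ⟹ isLine τ (f : Fin _) i a) ⊓
    pairMem (l : Fin _) y f

/-- `Prov_τ(y)`: the formula `y` of `L_∞` is provable from the axioms presented by `τ`. -/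
def isProvable (τ : F 1) {n : ℕ} (y : Fin n) : F n := exF fun f => isProof τ f (y : Fin _)

/-! ## Codes of formulas of `L_∈` and reflection -/

/-- `y` codes the term `s`: the variable `&i` is coded by the constant for the set `x` if
`e i = some x`, and by the variable `v_i` if `e i = none`. -/
def isTermCode {k n : ℕ} (e : ℕ → Option (Fin n)) (s : Lin.Term (Empty ⊕ Fin k)) (y : Fin n) : F n :=
  match s with
  | Term.var (Sum.inr i) =>
    match e i with
    | some x => isConstOf x y
    | none => exF fun m => isNumeral i m ⊓ isTagged 0 m (y : Fin _)
  | Term.var (Sum.inl z) => z.elim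
  | Term.func g _ => Empty.elim g

/-- Assignments of variables in scope remain meaningful below a quantifier. -/
def wk {n : ℕ} (e : ℕ → Option (Fin n)) : ℕ → Option (Fin (n + 1)) :=
  fun i => (e i).map Fin.castSucc

/-- `y` is the code of the formula of `L_∞` which results from `φ` by putting the constant for `x`
in place of the variable `&i` whenever `e i = some x`; other variables `&i` are named `v_i`. -/
def isCode : ∀ {k : ℕ}, F k → ∀ {n : ℕ}, (ℕ → Option (Fin n)) → Fin n → F n
  | _, BoundedFormula.falsum, _, _, y => isBot y
  | _, BoundedFormula.equal s t, _, e, y => exF fun a => exF fun b =>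
      isTermCode (wk (wk e)) s (a : Fin _) ⊓ isTermCode (wk (wk e)) t b ⊓ isEq (a : Fin _) b y
  | _, BoundedFormula.rel MemRel.mem ts, _, e, y => exF fun a => exF fun b =>
      isTermCode (wk (wk e)) (ts 0) (a : Fin _) ⊓ isTermCode (wk (wk e)) (ts 1) b ⊓
        isMem (a : Fin _) b y
  | _, BoundedFormula.imp φ ψ, _, e, y => exF fun a => exF fun b =>
      isCode φ (wk (wk e)) (a : Fin _) ⊓ isCode ψ (wk (wk e)) b ⊓ isImp (a : Fin _) b y
  | k, BoundedFormula.all φ, _, e, y => exF fun m => exF fun v => exF fun a =>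
      isNumeral k (m : Fin _) ⊓ isTagged 0 (m : Fin _) v ⊓ isCode φ (wk (wk (wk e))) a ⊓
        isAll (v : Fin _) a y

/-- `P(⌜φ(ẋ₀, …, ẋ_{k-1})⌝)`, a formula with the same free variables `x₀, …, x_{k-1}` as `φ`: each
free variable is replaced inside the code by the constant for its value. For a sentence `φ` this
is `P(⌜φ⌝)`. -/
def ofCode (P : ∀ {m : ℕ}, Fin m → F m) {k : ℕ} (φ : F k) : F k :=
  exF fun y =>
    isCode φ (fun i => if h : i < k then some (Fin.castSucc ⟨i, h⟩) else none) y ⊓ P y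

/-- `Prov_τ(⌜φ(ẋ₀, …, ẋ_{k-1})⌝)`. -/
def Prov (τ : F 1) {k : ℕ} (φ : F k) : F k := ofCode (fun y => isProvable τ y) φ

/-- `τ(⌜σ⌝)`. -/
def axiomOf (τ : F 1) (σ : Lin.Sentence) : Lin.Sentence :=
  ofCode (k := 0) (fun y => app τ ![y]) σ

/-- `∀ x (τ(x) → x is a formula of L_∈)`: the axioms presented by `τ` contain no constants. -/
def constantFree (τ : F 1) : Lin.Sentence := allF (n := 0) fun x => app τ ![x] ⟹ isFormIn x

/-- Local reflection: `Prov_τ(⌜σ⌝) → σ` for all sentences `σ` of `L_∈`. -/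
def Rfn (τ : F 1) : Lin.Theory := {ρ | ∃ σ : F 0, ρ = (Prov τ σ ⟹ σ)}

/-- Uniform reflection: `∀ x (Prov_τ(⌜φ(ẋ)⌝) → φ(x))` for all formulas `φ` of `L_∈` with at most one
free variable (with `k = 0` for the `φ` without free variables, where `∀ x` is void). -/
def RFN (τ : F 1) : Lin.Theory := {ρ | ∃ k ≤ 1, ∃ φ : F k, ρ = (Prov τ φ ⟹ φ).alls}

end SetRefl

namespace FODeriv

/-! ### Soundness of the natural deduction calculus. -/

section Soundness

variable {L : Language} {M : Type*} [L.Structure M]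

/-! The mathematical core is the theorem on constants, carried out inside `KPω`. Suppose `φ(ẋ)` has
a coded derivation from `τ`, for a single set `x`. The derivation is a finite sequence in the sense
of the theory, so some variable `u` occurs in none of its lines. Replace the constant for `x` by `u`
everywhere. Logical axioms go to logical axioms (`LogicalAxiom.repl`), axioms of `τ` are unchanged
because they contain no constants (`Repl.eq_of_formIn`), and modus ponens and generalization are
preserved. The outcome is a derivation of `φ(u)` (`Deriv.exists_fresh`, `Deriv.exists_repl`), and a
few more lines lead to `∀ x φ` (`Provable.all`). So one provable instance already makes the
universal closure provable, which is more than the first claim asks.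

For the second claim, let `Prov(φ(ẋ))` hold. Then `Prov(∀ x φ)` holds, local reflection for the
sentence `∀ x φ` makes it true, and `φ(x)` follows (`realize_RFN`). Conversely, local reflection is
the case of uniform reflection without free variables.

Derivability is handled semantically. By soundness and completeness (`proves_of_models`) it is
enough to argue in an arbitrary model `M` of `KPω`. Such an `M` may be ill-founded and its natural
numbers nonstandard, so codes and derivations of `M` need not be finite seen from outside. Every
induction on them is therefore an instance of the foundation scheme of `M`, applied to a property
defined by an explicit formula with parameters (`mem_induction`, `Dfn`). -/

theorem snoc_zero (xs : Fin 0 → M) (a : M) : (Fin.snoc xs a : Fin 1 → M) = fun _ => a := by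
  ext i
  obtain rfl : i = Fin.last 0 := Fin.ext (by omega)
  rw [Fin.snoc_last]

theorem realize_inst {φ : L.BoundedFormula ℕ 1} {t : L.Term ℕ} {v : ℕ → M} :
    (inst φ t).Realize v ↔ φ.Realize v (fun _ => t.realize v) := by
  rw [inst, Formula.Realize, BoundedFormula.realize_subst]
  have h := BoundedFormula.realize_toFormula φ (Sum.elim v (fun _ => t.realize v))
  rw [Formula.Realize] at h
  rw [Sum.elim_comp_inl, Sum.elim_comp_inr] at h
  rw [← h]
  have : (fun a => Term.realize v (Sum.elim Term.var (fun _ => t) a : L.Term ℕ)) =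
      (Sum.elim v (fun _ => t.realize v) : ℕ ⊕ Fin 1 → M) := by
    ext a; cases a <;> rfl
  rw [this]

theorem realize_congr_freeVarFinset {n : ℕ} (φ : L.BoundedFormula ℕ n) {v w : ℕ → M} {xs : Fin n → M}
    (h : ∀ i ∈ φ.freeVarFinset, v i = w i) : φ.Realize v xs ↔ φ.Realize w xs := by
  rw [← BoundedFormula.realize_restrictFreeVar (f := fun a => (a : ℕ)) (v := v) v (fun _ => rfl),
    BoundedFormula.realize_restrictFreeVar (f := fun a => (a : ℕ)) (v := v) w
      (fun a => h a a.2)]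

theorem Derives.sound [Nonempty M] {Γ : Set (L.Formula ℕ)} {φ : L.Formula ℕ} (h : Derives Γ φ) :
    ∀ v : ℕ → M, (∀ ψ ∈ Γ, ψ.Realize v) → φ.Realize v := by
  induction h with
  | ax h => exact fun v hv => hv _ h
  | impI _ ih =>
    intro v hv
    refine Formula.realize_imp.2 fun hφ => ih v ?_
    rintro ψ (rfl | hψ)
    exacts [hφ, hv _ hψ]
  | impE _ _ ih₁ ih₂ => exact fun v hv => Formula.realize_imp.1 (ih₁ v hv) (ih₂ v hv)
  | raa _ ih =>
    intro v hv
    by_contra hφ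
    refine ih v ?_
    rintro ψ (rfl | hψ)
    exacts [Formula.realize_not.2 hφ, hv _ hψ]
  | @allI Γ φ x hx hxφ _ ih =>
    intro v hv
    refine BoundedFormula.realize_all.2 fun a => ?_
    -- The eigenvariable `x` is reassigned to `a`. Since `x` is free in no hypothesis, all of `Γ`
    -- remains true.
    have h1 := realize_inst.1 (ih (Function.update v x a) fun ψ hψ => by
      refine (realize_congr_freeVarFinset ψ fun i hi => ?_).1 (hv ψ hψ)
      rw [Function.update_of_ne]
      rintro rfl
      exact hx ψ hψ hi)
    rw [realize_congr_freeVarFinset (w := v)] at h1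
    · rw [snoc_zero]
      simpa using h1
    · intro i hi
      rw [Function.update_of_ne]
      rintro rfl
      exact hxφ hi
  | allE t _ ih =>
    intro v hv
    rw [realize_inst, ← snoc_zero default]
    exact BoundedFormula.realize_all.1 (ih v hv) (t.realize v)
  | eqRefl t => exact fun v _ => Formula.realize_equal.2 rfl
  | eqSubst s t _ _ ih₁ ih₂ =>
    intro v hv
    have h := ih₂ v hv
    rw [realize_inst, Formula.realize_equal.1 (ih₁ v hv)] at h
    exact realize_inst.2 h

theorem realize_lift {σ : L.Sentence} {v : ℕ → M} : (lift σ).Realize v ↔ M ⊨ σ := by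
  rw [lift, Formula.realize_relabel, Sentence.Realize]
  rw [Subsingleton.elim (v ∘ _) default]

theorem Proves.sound [Nonempty M] {T : L.Theory} {σ : L.Sentence} (h : Proves T σ)
    (hM : M ⊨ T) : M ⊨ σ := by
  obtain ⟨a⟩ := ‹Nonempty M›
  have : Nonempty M := ⟨a⟩
  refine realize_lift.1 (Derives.sound h (fun _ => a) ?_)
  rintro _ ⟨ψ, hψ, rfl⟩
  exact realize_lift.2 (Theory.model_iff _ |>.1 hM ψ hψ)

end Soundness

/-! ### Formula size, and the absence of free variables in lifted sentences. -/

section Size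

variable {L : Language}

/-- The number of logical symbols of a formula. -/
def size {α : Type*} : ∀ {n : ℕ}, L.BoundedFormula α n → ℕ
  | _, .falsum => 0
  | _, .equal _ _ => 0
  | _, .rel _ _ => 0
  | _, .imp φ ψ => size φ + size ψ + 1
  | _, .all φ => size φ + 1

theorem size_castLE {α : Type*} {m : ℕ} (φ : L.BoundedFormula α m) :
    ∀ {n : ℕ} (h : m ≤ n), size (φ.castLE h) = size φ := by
  induction φ with
  | falsum => intros; rfl
  | equal => intros; rfl
  | rel => intros; rfl
  | imp _ _ ih₁ ih₂ => intros; simp [size, ih₁, ih₂]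
  | all _ ih => intros; simp [size, ih]

theorem size_mapTermRel {α β : Type*} {g : ℕ → ℕ}
    (ft : ∀ n, L.Term (α ⊕ (Fin n)) → L.Term (β ⊕ (Fin (g n))))
    (fr : ∀ n, L.Relations n → L.Relations n)
    (h : ∀ n, L.BoundedFormula β (g (n + 1)) → L.BoundedFormula β (g n + 1))
    (hh : ∀ n φ, size (h n φ) = size φ) {n : ℕ} (φ : L.BoundedFormula α n) :
    size (φ.mapTermRel ft fr h) = size φ := by
  induction φ with
  | falsum => rfl
  | equal => rfl
  | rel => rfl
  | imp _ _ ih₁ ih₂ => simp [size, BoundedFormula.mapTermRel, ih₁, ih₂]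
  | all _ ih => simp [size, BoundedFormula.mapTermRel, ih, hh]

theorem size_toFormula {α : Type*} {n : ℕ} (φ : L.BoundedFormula α n) :
    size φ.toFormula = size φ := by
  induction φ with
  | falsum => rfl
  | equal => rfl
  | rel => rfl
  | imp _ _ ih₁ ih₂ => simp [size, ih₁, ih₂]
  | all _ ih =>
    simp only [BoundedFormula.toFormula, size, BoundedFormula.relabel]
    rw [size_mapTermRel _ _ _ (fun _ φ => size_castLE φ _), ih]

theorem size_inst (φ : L.BoundedFormula ℕ 1) (t : L.Term ℕ) : size (inst φ t) = size φ := by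
  exact (size_mapTermRel (g := id) _ _ (fun _ => id) (fun _ _ => rfl) _).trans (size_toFormula φ)

/-- This lets any variable serve as an eigenvariable with respect to the axioms, so that only the
finitely many extra hypotheses in the Henkin construction restrict the choice. -/
theorem freeVarFinset_lift (σ : L.Sentence) (x : ℕ) :
    x ∉ BoundedFormula.freeVarFinset (lift σ) := by
  have key : ∀ {n : ℕ} (φ : L.BoundedFormula Empty n),
      x ∉ (φ.relabel (n := 0) (Sum.inl ∘ (fun e : Empty => (e.elim : ℕ)))).freeVarFinset := by
    intro n φ
    have ht : ∀ {n : ℕ} (t : L.Term (Empty ⊕ Fin n)), x ∉ (t.relabel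
        (BoundedFormula.relabelAux (n := 0) (Sum.inl ∘ (fun e : Empty => (e.elim : ℕ))) n)).varFinsetLeft := by
      intro n t
      induction t with
      | var a =>
        rcases a with a | a
        · exact a.elim
        · simp [BoundedFormula.relabelAux, Term.varFinsetLeft]
      | func f ts ih => simpa [Term.varFinsetLeft] using ih
    have hc : ∀ {m : ℕ} (φ : L.BoundedFormula ℕ m) {n : ℕ} (h : m ≤ n),
        (φ.castLE h).freeVarFinset = φ.freeVarFinset := by
      have htc : ∀ {m n : ℕ} (h : m ≤ n) (t : L.Term (ℕ ⊕ Fin m)),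
          (t.relabel (Sum.map id (Fin.castLE h))).varFinsetLeft = t.varFinsetLeft := by
        intro m n h t
        induction t with
        | var a => rcases a with a | a <;> rfl
        | func f ts ih => simp [Term.varFinsetLeft, ih]
      intro m φ
      induction φ with
      | falsum => intros; rfl
      | equal => intros; simp [htc]
      | rel => intros; simp [htc]
      | imp _ _ ih₁ ih₂ => intros; simp [ih₁, ih₂]
      | all _ ih => intros; simp [ih]
    induction φ with
    | falsum => simp
    | equal t₁ t₂ =>
      simp only [BoundedFormula.relabel, BoundedFormula.mapTermRel, BoundedFormula.freeVarFinset,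
        Finset.mem_union, not_or]
      exact ⟨ht _, ht _⟩
    | rel R ts =>
      simp only [BoundedFormula.relabel, BoundedFormula.mapTermRel, BoundedFormula.freeVarFinset,
        Finset.mem_biUnion, not_exists, not_and]
      exact fun i _ => ht _
    | imp _ _ ih₁ ih₂ => simp [ih₁, ih₂]
    | all _ ih => simpa using ih
  exact key σ

end Size
end FODeriv

namespace FODeriv

/-! ### Henkin sets of formulas. -/

section Henkin

/-- A set of formulas that decides every formula, has witnesses, and all of whose finite subsets are
consistent with `A`. -/
structure IsHenkin {L : Language} (A G : Set (L.Formula ℕ)) : Prop where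
  consistent : ∀ S : Finset (L.Formula ℕ), (∀ ψ ∈ S, ψ ∈ G) → ∃ Δ : Finset (L.Formula ℕ),
    S ⊆ Δ ∧ ¬ Derives (A ∪ Δ) BoundedFormula.falsum
  decides : ∀ ψ : L.Formula ℕ, ψ ∈ G ∨ BoundedFormula.not ψ ∈ G
  witness : ∀ φ : L.BoundedFormula ℕ 1,
    φ.all ∈ G ∨ ∃ x : ℕ, BoundedFormula.not (inst φ (Term.var x)) ∈ G

variable {L : Language} {A : Set (L.Formula ℕ)}

theorem derives_of_raa {Γ : Set (L.Formula ℕ)} {φ : L.Formula ℕ}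
    (h₁ : Derives (insert φ Γ) BoundedFormula.falsum)
    (h₂ : Derives (insert (BoundedFormula.not φ) Γ) BoundedFormula.falsum) :
    Derives Γ BoundedFormula.falsum :=
  (Derives.impI h₁).impE (.raa h₂)

open Classical in
theorem exists_consistent_decides {Δ : Finset (L.Formula ℕ)}
    (h : ¬ Derives (A ∪ Δ) BoundedFormula.falsum) (ψ : L.Formula ℕ) :
    ∃ Δ' : Finset (L.Formula ℕ), ¬ Derives (A ∪ Δ') BoundedFormula.falsum ∧ Δ ⊆ Δ' ∧
      (ψ ∈ Δ' ∨ BoundedFormula.not ψ ∈ Δ') := by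
  by_contra hc
  push Not at hc
  refine h (derives_of_raa (φ := ψ) ?_ ?_)
  · by_contra hn
    refine (hc (insert ψ Δ) ?_ (Finset.subset_insert _ _)).1 (Finset.mem_insert_self _ _)
    rwa [Finset.coe_insert, Set.union_insert]
  · by_contra hn
    refine (hc (insert (BoundedFormula.not ψ) Δ) ?_ (Finset.subset_insert _ _)).2
      (Finset.mem_insert_self _ _)
    rwa [Finset.coe_insert, Set.union_insert]

open Classical in
-- The members of `A` have no free variables and `Δ` is finite, so some `x` is fresh for `Δ` and
-- `φ`. If `¬ φ(x)` cannot be added consistently, then `φ(x)` and hence `∀ φ` is derivable, so `∀ φ`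
-- could be added. The free variables act as Henkin constants, without any extension of the
-- language.
theorem exists_consistent_witness (hA : ∀ ψ ∈ A, ∀ x, x ∉ BoundedFormula.freeVarFinset ψ)
    {Δ : Finset (L.Formula ℕ)}
    (h : ¬ Derives (A ∪ Δ) BoundedFormula.falsum) (φ : L.BoundedFormula ℕ 1) :
    ∃ Δ' : Finset (L.Formula ℕ), ¬ Derives (A ∪ Δ') BoundedFormula.falsum ∧ Δ ⊆ Δ' ∧
      (φ.all ∈ Δ' ∨ ∃ x : ℕ, BoundedFormula.not (inst φ (Term.var x)) ∈ Δ') := by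
  by_contra hc
  push Not at hc
  obtain ⟨x, hx⟩ := Infinite.exists_notMem_finset
    (φ.freeVarFinset ∪ Δ.biUnion fun ψ => BoundedFormula.freeVarFinset ψ)
  simp only [Finset.mem_union, Finset.mem_biUnion, not_or, not_exists, not_and] at hx
  have h₁ : Derives (insert φ.all (A ∪ Δ)) BoundedFormula.falsum := by
    by_contra hn
    refine (hc (insert φ.all Δ) ?_ (Finset.subset_insert _ _)).1 (Finset.mem_insert_self _ _)
    rwa [Finset.coe_insert, Set.union_insert]
  refine h ((Derives.impI h₁).impE (.allI x ?_ hx.1 (.raa ?_)))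
  · rintro ψ (hψ | hψ)
    exacts [hA ψ hψ x, hx.2 ψ hψ]
  · by_contra hn
    refine (hc (insert (BoundedFormula.not (inst φ (Term.var x))) Δ) ?_
      (Finset.subset_insert _ _)).2 x (Finset.mem_insert_self _ _)
    rwa [Finset.coe_insert, Set.union_insert]

open Classical in
-- A Rasiowa–Sikorski argument on the finite sets consistent with `A`, ordered by inclusion.
-- Deciding a given formula and providing a witness for a given quantifier are cofinal conditions,
-- and there are countably many of them, so some ideal meets them all; `G` is the union of its
-- members.
theorem exists_isHenkin [Countable L.Symbols]
    (hA : ∀ ψ ∈ A, ∀ x, x ∉ BoundedFormula.freeVarFinset ψ)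
    {Δ : Finset (L.Formula ℕ)} (h : ¬ Derives (A ∪ Δ) BoundedFormula.falsum) :
    ∃ G, IsHenkin A G ∧ (Δ : Set (L.Formula ℕ)) ⊆ G := by
  have : Countable (L.BoundedFormula ℕ 1) :=
    (Function.Injective.countable
      (f := fun φ => (⟨1, φ⟩ : Σ n, L.BoundedFormula ℕ n))) sigma_mk_injective
  have : Encodable (L.Formula ℕ ⊕ L.BoundedFormula ℕ 1) := Encodable.ofCountable _
  let P := {Δ : Finset (L.Formula ℕ) // ¬ Derives (A ∪ Δ) BoundedFormula.falsum}
  let D : L.Formula ℕ ⊕ L.BoundedFormula ℕ 1 → Order.Cofinal P := Sum.elim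
    (fun ψ => ⟨{p | ψ ∈ p.1 ∨ BoundedFormula.not ψ ∈ p.1}, fun p => by
      obtain ⟨Δ', h1, h2, h3⟩ := exists_consistent_decides p.2 ψ
      exact ⟨⟨Δ', h1⟩, h3, h2⟩⟩)
    (fun φ => ⟨{p | φ.all ∈ p.1 ∨ ∃ x : ℕ, BoundedFormula.not (inst φ (Term.var x)) ∈ p.1},
      fun p => by
      obtain ⟨Δ', h1, h2, h3⟩ := exists_consistent_witness hA p.2 φ
      exact ⟨⟨Δ', h1⟩, h3, h2⟩⟩)
  let I := Order.idealOfCofinals (⟨Δ, h⟩ : P) D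
  refine ⟨{ψ | ∃ p ∈ I, ψ ∈ p.1}, ⟨?_, ?_, ?_⟩, ?_⟩
  · intro S
    suffices hs : (∀ ψ ∈ S, ∃ p ∈ I, ψ ∈ p.1) → ∃ p ∈ I, S ⊆ p.1 by
      intro hS
      obtain ⟨p, -, hp⟩ := hs hS
      exact ⟨p.1, hp, p.2⟩
    induction S using Finset.induction_on with
    | empty => exact fun _ => ⟨_, Order.mem_idealOfCofinals _ D, Finset.empty_subset _⟩
    | insert ψ S _ ih =>
      intro hS
      obtain ⟨p, hpI, hp⟩ := ih fun χ hχ => hS χ (Finset.mem_insert_of_mem hχ)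
      obtain ⟨q, hqI, hq⟩ := hS ψ (Finset.mem_insert_self _ _)
      obtain ⟨r, hrI, hpr, hqr⟩ := I.directed _ hpI _ hqI
      exact ⟨r, hrI, Finset.insert_subset (hqr hq) (hp.trans hpr)⟩
  · intro ψ
    obtain ⟨p, hp, hpI⟩ := Order.cofinal_meets_idealOfCofinals (⟨Δ, h⟩ : P) D (.inl ψ)
    exact hp.imp (fun h => ⟨p, hpI, h⟩) (fun h => ⟨p, hpI, h⟩)
  · intro φ
    obtain ⟨p, hp, hpI⟩ := Order.cofinal_meets_idealOfCofinals (⟨Δ, h⟩ : P) D (.inr φ)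
    exact hp.imp (fun h => ⟨p, hpI, h⟩) (fun ⟨x, h⟩ => ⟨x, p, hpI, h⟩)
  · exact fun ψ hψ => ⟨_, Order.mem_idealOfCofinals _ D, hψ⟩

/-- The derivation is demanded from every finite `Δ ⊇ S`, which spares a weakening theorem for
`Derives`: consistency of `G` supplies some such `Δ` that also contains `¬ ψ`. -/
theorem IsHenkin.mem_of_derives {G : Set (L.Formula ℕ)} (hG : IsHenkin A G) {ψ : L.Formula ℕ}
    (S : Finset (L.Formula ℕ)) (hS : ∀ χ ∈ S, χ ∈ G)
    (h : ∀ Δ : Finset (L.Formula ℕ), S ⊆ Δ → Derives (A ∪ Δ) ψ) : ψ ∈ G := by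
  classical
  refine (hG.decides ψ).resolve_right fun hn => ?_
  obtain ⟨Δ, hΔ, hc⟩ := hG.consistent (insert (BoundedFormula.not ψ) S) (by
    intro χ hχ
    rcases Finset.mem_insert.1 hχ with rfl | hχ
    exacts [hn, hS χ hχ])
  refine hc (Derives.impE (φ := ψ) (.ax (Or.inr (hΔ (Finset.mem_insert_self _ _)))) (h Δ ?_))
  exact (Finset.subset_insert _ _).trans hΔ

theorem IsHenkin.falsum_notMem {G : Set (L.Formula ℕ)} (hG : IsHenkin A G) :
    BoundedFormula.falsum ∉ G := by
  intro h
  obtain ⟨Δ, hΔ, hc⟩ := hG.consistent {BoundedFormula.falsum} (by simpa using h)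
  exact hc (.ax (Or.inr (hΔ (Finset.mem_singleton_self _))))

theorem IsHenkin.mem_of_imp {G : Set (L.Formula ℕ)} (hG : IsHenkin A G) {φ ψ : L.Formula ℕ}
    (h : φ.imp ψ ∈ G) (hφ : φ ∈ G) : ψ ∈ G := by
  classical
  refine hG.mem_of_derives {φ.imp ψ, φ} (by simp [h, hφ]) fun Δ hΔ => ?_
  exact .impE (φ := φ) (.ax (Or.inr (hΔ (by simp)))) (.ax (Or.inr (hΔ (by simp))))

theorem IsHenkin.not_mem_iff {G : Set (L.Formula ℕ)} (hG : IsHenkin A G) {φ : L.Formula ℕ} :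
    BoundedFormula.not φ ∈ G ↔ φ ∉ G :=
  ⟨fun h h' => hG.falsum_notMem (hG.mem_of_imp h h'), fun h => (hG.decides φ).resolve_left h⟩

theorem IsHenkin.imp_mem_iff {G : Set (L.Formula ℕ)} (hG : IsHenkin A G) {φ ψ : L.Formula ℕ} :
    φ.imp ψ ∈ G ↔ (φ ∈ G → ψ ∈ G) := by
  refine ⟨hG.mem_of_imp, fun h => ?_⟩
  by_cases hφ : φ ∈ G
  · exact hG.mem_of_derives {ψ} (by simp [h hφ]) fun Δ hΔ =>
      .impI (.ax (Or.inr (Or.inr (hΔ (by simp)))))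
  · refine hG.mem_of_derives {BoundedFormula.not φ} (by simpa using hG.not_mem_iff.2 hφ)
      fun Δ hΔ => .impI (.raa ?_)
    exact .impE (φ := φ) (.ax (Or.inr (Or.inr (Or.inr (hΔ (Finset.mem_singleton_self _))))))
      (.ax (Or.inr (Or.inl rfl)))

theorem IsHenkin.all_mem_iff {G : Set (L.Formula ℕ)} (hG : IsHenkin A G)
    {φ : L.BoundedFormula ℕ 1} : φ.all ∈ G ↔ ∀ x : ℕ, inst φ (Term.var x) ∈ G := by
  refine ⟨fun h x => ?_, fun h => (hG.witness φ).resolve_right ?_⟩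
  · exact hG.mem_of_derives {φ.all} (by simp [h]) fun Δ hΔ => .allE _ (.ax (Or.inr (hΔ (by simp))))
  · rintro ⟨x, hx⟩
    exact hG.not_mem_iff.1 hx (h x)

theorem IsHenkin.equal_self_mem {G : Set (L.Formula ℕ)} (hG : IsHenkin A G) (t : L.Term ℕ) :
    t.equal t ∈ G :=
  hG.mem_of_derives ∅ (by simp) fun _ _ => .eqRefl t

theorem IsHenkin.inst_mem {G : Set (L.Formula ℕ)} (hG : IsHenkin A G) {φ : L.BoundedFormula ℕ 1}
    {s t : L.Term ℕ} (h : s.equal t ∈ G) (hs : inst φ s ∈ G) : inst φ t ∈ G := by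
  classical
  refine hG.mem_of_derives {s.equal t, inst φ s} (by simp [h, hs]) fun Δ hΔ => ?_
  exact .eqSubst s t (.ax (Or.inr (hΔ (by simp)))) (.ax (Or.inr (hΔ (by simp))))

theorem IsHenkin.mem_of_mem {G : Set (L.Formula ℕ)} (hG : IsHenkin A G) {φ : L.Formula ℕ}
    (h : φ ∈ A) : φ ∈ G :=
  hG.mem_of_derives ∅ (by simp) fun _ _ => .ax (Or.inl h)

end Henkin
end FODeriv

namespace SetRefl

open FODeriv

instance : Countable Lin.Symbols := by
  have : Countable (Σ l, Lin.Functions l) := by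
    have : ∀ l, Countable (Lin.Functions l) := fun l => inferInstanceAs (Countable Empty)
    infer_instance
  have : Countable (Σ l, Lin.Relations l) := by
    have : ∀ l, Countable (Lin.Relations l) := fun l =>
      ⟨fun _ => 0, fun a b _ => by cases a; cases b; rfl⟩
    infer_instance
  exact inferInstanceAs (Countable (_ ⊕ _))

/-- The formula `x = y`. -/
def eqVar (x y : ℕ) : Lin.Formula ℕ := (Term.var x).equal (Term.var y)

/-- The formula `x ∈ y`. -/
def memVar (x y : ℕ) : Lin.Formula ℕ :=
  Relations.formula₂ (L := Lin) MemRel.mem (Term.var x) (Term.var y)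

/-! ### The term model and completeness. -/

section TermModel

variable {A G : Set (Lin.Formula ℕ)}

theorem inst_equal_left (x y : ℕ) :
    inst (Term.bdEqual (&0) (Term.var (Sum.inl y)) : Lin.BoundedFormula ℕ 1) (Term.var x) =
      eqVar x y := rfl

theorem inst_mem_left (x y : ℕ) :
    inst (Relations.boundedFormula₂ (L := Lin) MemRel.mem (&0) (Term.var (Sum.inl y)) :
      Lin.BoundedFormula ℕ 1) (Term.var x) = memVar x y := by
  refine congrArg (BoundedFormula.rel _) (funext fun i => ?_)
  fin_cases i <;> rfl

theorem inst_mem_right (x y : ℕ) :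
    inst (Relations.boundedFormula₂ (L := Lin) MemRel.mem (Term.var (Sum.inl y)) (&0) :
      Lin.BoundedFormula ℕ 1) (Term.var x) = memVar y x := by
  refine congrArg (BoundedFormula.rel _) (funext fun i => ?_)
  fin_cases i <;> rfl

theorem _root_.FODeriv.IsHenkin.eqVar_symm (hG : IsHenkin A G) {x y : ℕ} (h : eqVar x y ∈ G) :
    eqVar y x ∈ G := by
  -- Leibniz's law for the formula `z = x` in the variable `z`, passing from `x = x` to `y = x`.
  rw [← inst_equal_left]
  refine hG.inst_mem h ?_
  rw [inst_equal_left]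
  exact hG.equal_self_mem _

/-- Equality of variables modulo `G`. -/
def termSetoid (hG : IsHenkin A G) : Setoid ℕ where
  r x y := eqVar x y ∈ G
  iseqv := ⟨fun _ => hG.equal_self_mem _, hG.eqVar_symm, fun {x y z} h₁ h₂ => by
    have h₃ := hG.eqVar_symm h₁
    rw [← inst_equal_left] at h₂ ⊢
    exact hG.inst_mem h₃ h₂⟩

theorem memVar_congr (hG : IsHenkin A G) {x x' y y' : ℕ} (hx : eqVar x x' ∈ G)
    (hy : eqVar y y' ∈ G) (h : memVar x y ∈ G) : memVar x' y' ∈ G := by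
  rw [← inst_mem_left] at h
  have h := hG.inst_mem hx h
  rw [inst_mem_left, ← inst_mem_right] at h
  have h := hG.inst_mem hy h
  rwa [inst_mem_right] at h

/-- The model whose elements are the variables modulo `G`. -/
def TermModel (hG : IsHenkin A G) : Type := Quotient (termSetoid hG)

/-- The class of a variable. -/
def TermModel.mk (hG : IsHenkin A G) (x : ℕ) : TermModel hG := Quotient.mk _ x

instance (hG : IsHenkin A G) : Lin.Structure (TermModel hG) where
  funMap f := Empty.elim f
  RelMap {n} r xs := match n, r, xs with
    | _, MemRel.mem, xs => Quotient.lift₂ (fun x y => memVar x y ∈ G) (fun _ _ _ _ hx hy =>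
        propext ⟨memVar_congr hG hx hy, memVar_congr hG (hG.eqVar_symm hx) (hG.eqVar_symm hy)⟩)
          (xs 0) (xs 1)

instance (hG : IsHenkin A G) : Nonempty (TermModel hG) := ⟨.mk hG 0⟩

theorem exists_eq_var (t : Lin.Term (ℕ ⊕ Fin 0)) : ∃ x : ℕ, t = Term.var (Sum.inl x) := by
  rcases t with (x | i) | ⟨f, -⟩
  exacts [⟨x, rfl⟩, i.elim0, f.elim]

/-- The truth lemma. The induction is on size because `inst φ (Term.var x)` is not a subformula of
`φ.all`, though it has the size of `φ`. Instances at variables suffice since every element of the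
model is the class of a variable. -/
theorem realize_termModel (hG : IsHenkin A G) : ∀ (n : ℕ) (φ : Lin.Formula ℕ), size φ ≤ n →
    (φ.Realize (TermModel.mk hG) ↔ φ ∈ G) := by
  intro n
  induction n using Nat.strong_induction_on with
  | _ n ih =>
    intro φ hφ
    cases φ with
    | falsum => exact ⟨fun h => h.elim, fun h => (hG.falsum_notMem h).elim⟩
    | equal s t =>
      obtain ⟨x, rfl⟩ := exists_eq_var s
      obtain ⟨y, rfl⟩ := exists_eq_var t
      exact ⟨fun h => Quotient.exact (s := termSetoid hG) h,
        fun h => Quotient.sound (s := termSetoid hG) h⟩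
    | rel r ts =>
      rename_i k
      cases r
      obtain ⟨x, hx⟩ := exists_eq_var (ts 0)
      obtain ⟨y, hy⟩ := exists_eq_var (ts 1)
      have e : (BoundedFormula.rel (L := Lin) MemRel.mem ts : Lin.Formula ℕ) = memVar x y := by
        refine congrArg (BoundedFormula.rel _) (funext fun i => ?_)
        fin_cases i
        exacts [hx, hy]
      have h : (memVar x y).Realize (TermModel.mk hG) ↔ memVar x y ∈ G := Iff.rfl
      exact e ▸ h
    | imp φ ψ =>
      simp only [size] at hφ
      rw [Formula.realize_imp, hG.imp_mem_iff, ih (size φ) (by omega) φ le_rfl,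
        ih (size ψ) (by omega) ψ le_rfl]
    | all φ =>
      simp only [size] at hφ
      rw [hG.all_mem_iff]
      refine (BoundedFormula.realize_all (θ := φ) (xs := default)).trans ?_
      have key : ∀ x : ℕ, φ.Realize (TermModel.mk hG)
          (Fin.snoc default (TermModel.mk hG x)) ↔ inst φ (Term.var x) ∈ G := by
        intro x
        rw [← ih (size φ) (by omega) _ (size_inst φ _).le, realize_inst, snoc_zero]
        rfl
      exact ⟨fun h x => (key x).1 (h _), fun h a => by
        induction a using Quotient.inductionOn with
        | h x => exact (key x).2 (h x)⟩

end TermModel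

/-- Gödel's completeness theorem for the language of set theory. -/
theorem proves_of_models {T : Lin.Theory} {σ : Lin.Sentence}
    (h : ∀ (M : Type) [Lin.Structure M] [Nonempty M], M ⊨ T → M ⊨ σ) : Proves T σ := by
  by_contra hn
  obtain ⟨G, hG, hσ⟩ := exists_isHenkin (A := lift '' T)
    (Δ := {BoundedFormula.not (lift σ)}) (by
      rintro _ ⟨ψ, -, rfl⟩ x
      exact freeVarFinset_lift ψ x) (by
      intro h
      refine hn (.raa ?_)
      rwa [Finset.coe_singleton, Set.union_singleton] at h)
  have hT : TermModel hG ⊨ T := (Theory.model_iff _).2 fun ψ hψ =>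
    (realize_lift (v := TermModel.mk hG)).1 ((realize_termModel hG _ _ le_rfl).2 (hG.mem_of_mem ⟨ψ, hψ, rfl⟩))
  have h₁ := (realize_termModel hG _ _ le_rfl).1 (realize_lift.2 (h _ hT))
  exact hG.not_mem_iff.1 (hσ (by simp)) h₁


/-! ### Satisfaction of the basic formulas -/

section Satisfaction

variable {M : Type} [Lin.Structure M]

/-- The membership relation of a structure. -/
def E (x y : M) : Prop := Structure.RelMap (L := Lin) MemRel.mem ![x, y]

infix:50 " ε " => E

/-- `v` satisfies `φ`. -/
def Sat {n : ℕ} (φ : F n) (v : Fin n → M) : Prop := φ.Realize default v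

variable {n : ℕ} {v : Fin n → M}

@[simp] theorem sat_eqF {x y : Fin n} : Sat (eqF x y) v ↔ v x = v y := Iff.rfl

@[simp] theorem sat_memF {x y : Fin n} : Sat (memF x y) v ↔ v x ε v y :=
  BoundedFormula.realize_rel₂

@[simp] theorem sat_imp {φ ψ : F n} : Sat (φ ⟹ ψ) v ↔ (Sat φ v → Sat ψ v) := Iff.rfl

@[simp] theorem sat_not {φ : F n} : Sat (∼φ) v ↔ ¬ Sat φ v := Iff.rfl

@[simp] theorem sat_and {φ ψ : F n} : Sat (φ ⊓ ψ) v ↔ Sat φ v ∧ Sat ψ v :=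
  BoundedFormula.realize_inf

@[simp] theorem sat_or {φ ψ : F n} : Sat (φ ⊔ ψ) v ↔ Sat φ v ∨ Sat ψ v :=
  BoundedFormula.realize_sup

@[simp] theorem sat_iff {φ ψ : F n} : Sat (φ ⇔ ψ) v ↔ (Sat φ v ↔ Sat ψ v) :=
  BoundedFormula.realize_iff

@[simp] theorem sat_all {φ : F (n + 1)} :
    Sat φ.all v ↔ ∀ x, Sat φ (Fin.snoc v x) := Iff.rfl

@[simp] theorem sat_allF {f : Fin (n + 1) → F (n + 1)} :
    Sat (allF f) v ↔ ∀ x, Sat (f (Fin.last n)) (Fin.snoc v x) := Iff.rfl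

@[simp] theorem sat_exF {f : Fin (n + 1) → F (n + 1)} :
    Sat (exF f) v ↔ ∃ x, Sat (f (Fin.last n)) (Fin.snoc v x) := BoundedFormula.realize_ex

@[simp] theorem sat_ballF {y : Fin n} {f : Fin (n + 1) → F (n + 1)} :
    Sat (ballF y f) v ↔ ∀ x, x ε v y → Sat (f (Fin.last n)) (Fin.snoc v x) := by
  simp [ballF]

@[simp] theorem sat_bexF {y : Fin n} {f : Fin (n + 1) → F (n + 1)} :
    Sat (bexF y f) v ↔ ∃ x, x ε v y ∧ Sat (f (Fin.last n)) (Fin.snoc v x) := by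
  simp [bexF]

@[simp] theorem sat_app {k : ℕ} {φ : F k} {w : Fin k → Fin n} :
    Sat (app φ w) v ↔ Sat φ (v ∘ w) := by
  unfold Sat app
  rw [BoundedFormula.realize_relabel (n := 0)]
  have h := BoundedFormula.realize_toFormula φ (Sum.elim default (v ∘ w))
  rw [Sum.elim_comp_inl, Sum.elim_comp_inr] at h
  rw [← h, Formula.Realize]
  have e : (Sum.elim (default : Empty → M) (v ∘ Fin.castAdd 0) ∘
      (Sum.elim (fun e : Empty => e.elim) (fun i => Sum.inr (w i)) :
        Empty ⊕ Fin k → Empty ⊕ Fin n)) = Sum.elim default (v ∘ w) := by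
    ext a
    rcases a with a | a
    exacts [a.elim, rfl]
  rw [e]
  exact iff_of_eq (congrArg _ (Subsingleton.elim (α := Fin 0 → M) _ _))

theorem sat_alls {φ : F n} : M ⊨ φ.alls ↔ ∀ v : Fin n → M, Sat φ v :=
  BoundedFormula.realize_alls

theorem sat_sentence {φ : F 0} : M ⊨ φ ↔ Sat φ (default : Fin 0 → M) := Iff.rfl

@[simp] theorem comp_snoc {α β : Type*} {k : ℕ} (g : α → β) (f : Fin k → α) (x : α) :
    g ∘ (Fin.snoc f x : Fin (k + 1) → α) = Fin.snoc (g ∘ f) (g x) := by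
  ext i
  refine Fin.lastCases ?_ (fun i => ?_) i <;> simp

@[simp] theorem snoc_comp_castSucc {α β : Type*} {k : ℕ} (f : Fin k → α) (x : α) (g : β → Fin k) :
    ((Fin.snoc f x : Fin (k + 1) → α) ∘ fun i => Fin.castSucc (g i)) = f ∘ g := by
  ext i
  simp

end Satisfaction

/-! ### Elementary set theory in a model of `KPω` -/

section Axioms

variable {M : Type} [Lin.Structure M] [hM : M ⊨ KPomega]

theorem ext_mem {x y : M} (h : ∀ z, z ε x ↔ z ε y) : x = y := by
  have := hM.realize_of_mem _ KPw.extensionality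
  rw [sat_sentence] at this
  simp [extensionality] at this
  exact this x y h

theorem exists_pairing (x y : M) : ∃ a, x ε a ∧ y ε a := by
  have := hM.realize_of_mem _ KPw.pairing
  rw [sat_sentence] at this
  simp [pairing] at this
  exact this x y

theorem exists_union (a : M) : ∃ b, ∀ y, y ε a → ∀ x, x ε y → x ε b := by
  have := hM.realize_of_mem _ KPw.union
  rw [sat_sentence] at this
  simp [union] at this
  exact this a

theorem exists_mem_minimal {n : ℕ} (φ : F (n + 1)) (p : Fin n → M) (h : ∃ x, Sat φ (Fin.snoc p x)) :
    ∃ x, Sat φ (Fin.snoc p x) ∧ ∀ y, y ε x → ¬ Sat φ (Fin.snoc p y) := by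
  have := hM.realize_of_mem _ (KPw.foundation φ)
  rw [foundation, sat_alls] at this
  have := this p
  simp at this
  obtain ⟨a, ha⟩ := h
  exact this a ha

theorem exists_separation {n : ℕ} {φ : F (n + 1)} (hφ : IsDelta0 φ) (p : Fin n → M) (a : M) :
    ∃ b, ∀ x, x ε b ↔ x ε a ∧ Sat φ (Fin.snoc p x) := by
  have := hM.realize_of_mem _ (KPw.separation hφ)
  rw [separation, sat_alls] at this
  have := this p
  simp at this
  exact this a

end Axioms

/-! ### Definable properties and induction along membership. -/

section Definable

variable {M : Type} [Lin.Structure M]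

/-- A property is definable if some formula with parameters defines it. -/
def Dfn (P : M → Prop) : Prop :=
  ∃ (k : ℕ) (φ : F (k + 1)) (p : Fin k → M), ∀ x, Sat φ (Fin.snoc p x) ↔ P x

/-- The formula is given as a builder `f` that works in every context, receiving the positions of
the parameters and of the argument. Definitions can then be written with the named quantifiers
`allF` and `exF`, and `simp` evaluates them. -/
theorem Dfn.of {P : M → Prop} {k : ℕ} (p : Fin k → M) (f : ∀ {n : ℕ}, (Fin k → Fin n) → Fin n → F n)
    (h : ∀ (n : ℕ) (v : Fin n → M) (i : Fin k → Fin n) (x : Fin n), (∀ j, v (i j) = p j) →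
      (Sat (f i x) v ↔ P (v x))) : Dfn P :=
  ⟨k, f (fun j => Fin.castSucc j) (Fin.last k), p, fun x =>
    (h _ _ _ _ fun j => Fin.snoc_castSucc _ _ _).trans (by rw [Fin.snoc_last])⟩

end Definable

section Induction

variable {M : Type} [Lin.Structure M] [hM : M ⊨ KPomega]

/-- Induction along membership for definable properties. -/
theorem mem_induction {P : M → Prop} (hP : Dfn P) (h : ∀ x, (∀ y, y ε x → P y) → P x) (x : M) :
    P x := by
  obtain ⟨k, φ, p, hφ⟩ := hP
  by_contra hx
  obtain ⟨y, hy, hm⟩ := exists_mem_minimal (∼φ) p ⟨x, by simpa [hφ] using hx⟩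
  simp only [sat_not, hφ, not_not] at hy hm
  exact hy (h y hm)

end Induction


noncomputable section

/-! ### Pairs, numerals and tagged codes in a model. -/

section Constructions

variable {M : Type} [Lin.Structure M] [hM : M ⊨ KPomega]

variable (M) in
theorem exists_empty : ∃ z : M, ∀ w, ¬ w ε z := by
  have := hM.realize_of_mem _ KPw.infinity
  rw [sat_sentence] at this
  simp [infinity, isEmpty] at this
  obtain ⟨w, ⟨z, -, hz⟩, -⟩ := this
  exact ⟨z, hz⟩

theorem exists_upair (x y : M) : ∃ z, ∀ w, w ε z ↔ w = x ∨ w = y := by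
  obtain ⟨a, hx, hy⟩ := exists_pairing x y
  -- A disjunction unfolds to `(φ ⟹ ⊥) ⟹ ψ`, so it is `Δ₀` by the clauses for `⟹` and `⊥`.
  obtain ⟨b, hb⟩ := exists_separation (n := 2) (φ := eqF 2 0 ⊔ eqF 2 1)
    (.imp (.imp (.eq _ _) .falsum) (.eq _ _)) ![x, y] a
  refine ⟨b, fun w => (hb w).trans ?_⟩
  simp
  rintro (rfl | rfl)
  exacts [hx, hy]

theorem exists_cup (x y : M) : ∃ z, ∀ w, w ε z ↔ w ε x ∨ w ε y := by
  obtain ⟨c, hx, hy⟩ := exists_pairing x y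
  obtain ⟨a, ha⟩ := exists_union c
  obtain ⟨b, hb⟩ := exists_separation (n := 2) (φ := memF 2 0 ⊔ memF 2 1)
    (.imp (.imp (.mem _ _) .falsum) (.mem _ _)) ![x, y] a
  refine ⟨b, fun w => (hb w).trans ?_⟩
  simp
  rintro (h | h)
  exacts [ha _ hx _ h, ha _ hy _ h]

/-- The empty set. -/
def emp : M := (exists_empty M).choose

/-- The unordered pair `{x, y}`. -/
def upair (x y : M) : M := (exists_upair x y).choose

/-- The union `x ∪ y`. -/
def cup (x y : M) : M := (exists_cup x y).choose

/-- The ordered pair `⟨x, y⟩`. -/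
def pr (x y : M) : M := upair (upair x x) (upair x y)

/-- The successor `x ∪ {x}`. -/
def suc (x : M) : M := cup x (upair x x)

/-- The numeral of `k`. -/
def num : ℕ → M
  | 0 => emp
  | k + 1 => suc (num k)

/-- The tagged set `⟨k, a⟩`. -/
def tag (k : ℕ) (a : M) : M := pr (num k) a

/-- The set `w ∪ {x}`. -/
def ins (x w : M) : M := cup w (upair x x)

@[simp] theorem not_mem_emp (w : M) : ¬ w ε (emp : M) := (exists_empty M).choose_spec w

@[simp] theorem mem_upair {x y w : M} : w ε upair x y ↔ w = x ∨ w = y :=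
  (exists_upair x y).choose_spec w

@[simp] theorem mem_cup {x y w : M} : w ε cup x y ↔ w ε x ∨ w ε y :=
  (exists_cup x y).choose_spec w

@[simp] theorem mem_suc {x w : M} : w ε suc x ↔ w ε x ∨ w = x := by simp [suc]

@[simp] theorem mem_ins {x w z : M} : z ε ins x w ↔ z = x ∨ z ε w := by simp [ins, or_comm]

theorem mem_pr {x y w : M} : w ε pr x y ↔ w = upair x x ∨ w = upair x y := by simp [pr]

theorem eq_iff_mem {x y : M} : x = y ↔ ∀ z, z ε x ↔ z ε y :=
  ⟨by rintro rfl; simp, ext_mem⟩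

theorem upair_eq {a b c d : M} :
    upair a b = upair c d ↔ (a = c ∧ b = d) ∨ (a = d ∧ b = c) := by
  constructor
  · intro h
    have h' : ∀ w, (w = a ∨ w = b) ↔ (w = c ∨ w = d) := fun w => by
      rw [← mem_upair, h, mem_upair]
    have h1 := h' a; have h2 := h' b; have h3 := h' c; have h4 := h' d
    grind
  · rintro (⟨rfl, rfl⟩ | ⟨rfl, rfl⟩)
    · rfl
    · exact ext_mem fun z => by simp [or_comm]

@[simp] theorem pr_inj {a b c d : M} : pr a b = pr c d ↔ a = c ∧ b = d := by
  unfold pr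
  simp only [upair_eq]
  grind

theorem not_mem_self (x : M) : ¬ x ε x := by
  refine mem_induction (P := fun x => ¬ x ε x) (.of ![] (fun _ x => ∼(memF x x)) ?_) ?_ x
  · simp
  · exact fun x h hx => h x hx hx

theorem num_mem_num {k l : ℕ} (h : k < l) : (num k : M) ε num l := by
  induction l with
  | zero => omega
  | succ l ih =>
    rw [num, mem_suc]
    rcases Nat.lt_succ_iff_lt_or_eq.1 h with h | rfl
    exacts [.inl (ih h), .inr rfl]

-- A smaller numeral is a member of a larger one, and no set is a member of itself. Distinct tags
-- therefore give distinct codes, which keeps the syntactic kinds apart.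
@[simp] theorem num_inj {k l : ℕ} : (num k : M) = num l ↔ k = l := by
  refine ⟨fun h => ?_, fun h => h ▸ rfl⟩
  by_contra hn
  rcases lt_or_gt_of_ne hn with hl | hl
  · have := num_mem_num (M := M) hl
    rw [h] at this
    exact not_mem_self _ this
  · have := num_mem_num (M := M) hl
    rw [h] at this
    exact not_mem_self _ this

@[simp] theorem tag_inj {k l : ℕ} {a b : M} : tag k a = tag l b ↔ k = l ∧ a = b := by
  simp [tag]

/-- `z` is an element of an element of an element of an element of `x`. -/
theorem mem_mem_of_tag_left (k : ℕ) (a b : M) : ∃ x₁ x₂ x₃, a ε x₁ ∧ x₁ ε x₂ ∧ x₂ ε x₃ ∧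
    x₃ ε tag k (pr a b) :=
  ⟨upair a b, pr a b, upair (num k) (pr a b), by simp, by simp [mem_pr], by simp,
    by simp [tag, mem_pr]⟩

theorem mem_mem_of_tag_right (k : ℕ) (a b : M) : ∃ x₁ x₂ x₃, b ε x₁ ∧ x₁ ε x₂ ∧ x₂ ε x₃ ∧
    x₃ ε tag k (pr a b) :=
  ⟨upair a b, pr a b, upair (num k) (pr a b), by simp, by simp [mem_pr], by simp,
    by simp [tag, mem_pr]⟩

/-- Induction on codes: a definable property holds of `x` if it holds of `x` whenever it holds of
the components of the pair that is tagged in `x`. -/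
theorem code_induction {P : M → Prop} (hP : Dfn P)
    (h : ∀ x, (∀ k a b, x = tag k (pr a b) → P a ∧ P b) → P x) (x : M) : P x := by
  obtain ⟨k, φ, p, hφ⟩ := hP
  -- With Kuratowski pairs the components lie four membership steps below the code. Carrying `P` for
  -- all elements down to depth three makes the hypothesis at a member `x₃` of the code reach them.
  have key : ∀ x, P x ∧ ∀ x₁, x₁ ε x → P x₁ ∧ ∀ x₂, x₂ ε x₁ → P x₂ ∧ ∀ x₃, x₃ ε x₂ → P x₃ := by
    refine mem_induction ⟨k, φ ⊓ ballF (Fin.last k) fun x₁ =>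
      app φ (Fin.snoc (fun i => Fin.castSucc (Fin.castSucc i)) x₁) ⊓
      ballF x₁ fun x₂ =>
        app φ (Fin.snoc (fun i => Fin.castSucc (Fin.castSucc (Fin.castSucc i))) x₂) ⊓
        ballF x₂ fun x₃ => app φ (Fin.snoc
          (fun i => Fin.castSucc (Fin.castSucc (Fin.castSucc (Fin.castSucc i)))) x₃),
      p, fun x => by simp [hφ]⟩ fun x ih => ?_
    refine ⟨h x ?_, fun x₁ h₁ => ⟨(ih x₁ h₁).1, fun x₂ h₂ => ⟨((ih x₁ h₁).2 x₂ h₂).1, fun x₃ h₃ =>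
      (((ih x₁ h₁).2 x₂ h₂).2 x₃ h₃).1⟩⟩⟩
    rintro k a b rfl
    constructor
    · obtain ⟨x₁, x₂, x₃, h1, h2, h3, h4⟩ := mem_mem_of_tag_left k a b
      exact (((ih x₃ h4).2 x₂ h3).2 x₁ h2).2 a h1
    · obtain ⟨x₁, x₂, x₃, h1, h2, h3, h4⟩ := mem_mem_of_tag_right k a b
      exact (((ih x₃ h4).2 x₂ h3).2 x₁ h2).2 b h1
  exact (key x).1

end Constructions

end


/-! ### Meaning of the basic formulas; natural numbers of a model. -/

section SatBasic

variable {M : Type} [Lin.Structure M] [hM : M ⊨ KPomega] {n : ℕ} {v : Fin n → M}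

theorem eq_emp_iff {x : M} : x = emp ↔ ∀ w, ¬ w ε x := by
  rw [eq_iff_mem]; simp

@[simp] theorem sat_isEmpty {x : Fin n} : Sat (isEmpty x) v ↔ v x = emp := by
  simp [isEmpty, eq_emp_iff]

@[simp] theorem sat_isSucc {x y : Fin n} : Sat (isSucc x y) v ↔ v y = suc (v x) := by
  simp [isSucc, eq_iff_mem]

@[simp] theorem sat_isUpair {x y z : Fin n} :
    Sat (isUpair x y z) v ↔ v z = upair (v x) (v y) := by
  simp [isUpair, eq_iff_mem (x := v z)]

@[simp] theorem sat_isPair {x y z : Fin n} : Sat (isPair x y z) v ↔ v z = pr (v x) (v y) := by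
  simp [isPair, eq_iff_mem (x := v z), mem_pr]

@[simp] theorem sat_pairMem {x y z : Fin n} : Sat (pairMem x y z) v ↔ pr (v x) (v y) ε v z := by
  simp [pairMem]

@[simp] theorem sat_isNumeral {k : ℕ} : ∀ {n : ℕ} {v : Fin n → M} {x : Fin n},
    Sat (isNumeral k x) v ↔ v x = num k := by
  induction k with
  | zero => simp [isNumeral, num]
  | succ k ih => simp [isNumeral, num, ih]

@[simp] theorem sat_isTagged {k : ℕ} {a y : Fin n} :
    Sat (isTagged k a y) v ↔ v y = tag k (v a) := by
  simp [isTagged, tag]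

@[simp] theorem sat_isTagged₂ {k : ℕ} {a b y : Fin n} :
    Sat (isTagged₂ k a b y) v ↔ v y = tag k (pr (v a) (v b)) := by
  simp [isTagged₂]

/-- `x` is a transitive set. -/
def Trans (x : M) : Prop := ∀ y, y ε x → ∀ z, z ε y → z ε x

/-- `x` is zero or a successor. -/
def ZeroOrSucc (x : M) : Prop := x = emp ∨ ∃ y, x = suc y

/-- `x` is a natural number of the model. -/
def IsNat (x : M) : Prop :=
  ((Trans x ∧ ∀ y, y ε x → Trans y) ∧ ZeroOrSucc x) ∧ ∀ y, y ε x → ZeroOrSucc y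

omit hM in
@[simp] theorem sat_isTrans {x : Fin n} : Sat (isTrans x) v ↔ Trans (v x) := by
  simp [isTrans, Trans]

@[simp] theorem sat_isZeroOrSucc {x : Fin n} : Sat (isZeroOrSucc x) v ↔ ZeroOrSucc (v x) := by
  simp [isZeroOrSucc, ZeroOrSucc]

@[simp] theorem sat_isNat {x : Fin n} : Sat (isNat x) v ↔ IsNat (v x) := by
  simp [isNat, IsNat]

/-- `x ≤ y` for natural numbers of the model. -/
def Le (x y : M) : Prop := x ε y ∨ x = y

theorem IsNat.of_mem {x y : M} (h : IsNat x) (hy : y ε x) : IsNat y := by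
  obtain ⟨⟨⟨h1, h2⟩, h3⟩, h4⟩ := h
  exact ⟨⟨⟨h2 y hy, fun z hz => h2 z (h1 y hy z hz)⟩, h4 y hy⟩, fun z hz => h4 z (h1 y hy z hz)⟩

theorem isNat_emp : IsNat (emp : M) := by
  simp [IsNat, Trans, ZeroOrSucc]

theorem IsNat.suc {x : M} (h : IsNat x) : IsNat (suc x) := by
  obtain ⟨⟨⟨h1, h2⟩, h3⟩, h4⟩ := h
  refine ⟨⟨⟨?_, ?_⟩, .inr ⟨x, rfl⟩⟩, ?_⟩
  · intro y hy z hz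
    rcases mem_suc.1 hy with hy | rfl
    exacts [mem_suc.2 (.inl (h1 y hy z hz)), mem_suc.2 (.inl hz)]
  · intro y hy
    rcases mem_suc.1 hy with hy | rfl
    exacts [h2 y hy, h1]
  · intro y hy
    rcases mem_suc.1 hy with hy | rfl
    exacts [h4 y hy, h3]

theorem IsNat.trans {x y z : M} (hx : IsNat x) (hy : y ε x) (hz : z ε y) : z ε x :=
  hx.1.1.1 y hy z hz

/-- A double induction along membership. If `x` and `y` were incomparable, each element of either
would be comparable with the other, and transitivity would leave only membership in it. Then `x` and
`y` have the same elements. -/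
theorem IsNat.trichotomy (x : M) : IsNat x → ∀ y, IsNat y → x ε y ∨ x = y ∨ y ε x := by
  refine mem_induction (P := fun x => IsNat x → ∀ y, IsNat y → x ε y ∨ x = y ∨ y ε x)
    (.of ![] (fun _ x => isNat x ⟹ allF fun y => isNat y ⟹
      (memF (x : Fin _) y ⊔ (eqF (x : Fin _) y ⊔ memF y (x : Fin _)))) (by simp)) ?_ x
  intro x ih hx
  refine mem_induction (.of ![x] (fun i y => isNat y ⟹
      (memF (i 0) y ⊔ (eqF (i 0) y ⊔ memF y (i 0)))) (by simp +contextual)) ?_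
  intro y ih' hy
  by_contra! hn
  refine hn.2.1 (ext_mem fun z => ⟨fun hz => ?_, fun hz => ?_⟩)
  · rcases ih z hz (hx.of_mem hz) y hy with h | rfl | h
    exacts [h, (hn.2.2 hz).elim, (hn.2.2 (hx.trans hz h)).elim]
  · rcases ih' z hz (hy.of_mem hz) with h | rfl | h
    exacts [(hn.1 (hy.trans hz h)).elim, (hn.1 hz).elim, h]

theorem Le.trans {x y z : M} (hz : IsNat z) (h₁ : Le x y) (h₂ : Le y z) : Le x z := by
  rcases h₂ with h₂ | rfl
  · rcases h₁ with h₁ | rfl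
    exacts [.inl (hz.trans h₂ h₁), .inl h₂]
  · exact h₁

theorem exists_max {x y : M} (hx : IsNat x) (hy : IsNat y) :
    ∃ z, IsNat z ∧ ∀ w, IsNat w → Le z w → Le x w ∧ Le y w := by
  rcases IsNat.trichotomy x hx y hy with h | rfl | h
  · exact ⟨y, hy, fun w hw h' => ⟨Le.trans hw (.inl h) h', h'⟩⟩
  · exact ⟨x, hx, fun w _ h' => ⟨h', h'⟩⟩
  · exact ⟨x, hx, fun w hw h' => ⟨h', Le.trans hw (.inl h) h'⟩⟩

end SatBasic


/-! ### Inductive notions defined by witnessing sets. -/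

section Witness

variable {M : Type} [Lin.Structure M]

/-- `y` belongs to a set each of whose members `a` satisfies `Φ` relative to that set. -/
def Wit (Φ : (M → Prop) → M → Prop) (y : M) : Prop :=
  ∃ w, y ε w ∧ ∀ a, a ε w → Φ (fun x => x ε w) a

/-- If `Φ` is monotone and each instance depends on at most two members of the set, then `Wit Φ` is
a fixed point of `Φ`. -/
theorem wit_iff [hM : M ⊨ KPomega] {Φ : (M → Prop) → M → Prop}
    (mono : ∀ S S' : M → Prop, (∀ x, S x → S' x) → ∀ a, Φ S a → Φ S' a)
    (fin : ∀ (S : M → Prop) a, Φ S a → Φ (fun _ => False) a ∨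
      ∃ b c, S b ∧ S c ∧ Φ (fun x => x = b ∨ x = c) a) (y : M) :
    Wit Φ y ↔ Φ (Wit Φ) y := by
  constructor
  · rintro ⟨w, hy, hw⟩
    exact mono _ _ (fun x hx => ⟨w, hx, hw⟩) _ (hw y hy)
  · intro h
    rcases fin _ _ h with h | ⟨b, c, ⟨w₁, hb, h₁⟩, ⟨w₂, hc, h₂⟩, h⟩
    · refine ⟨ins y emp, by simp, fun a ha => ?_⟩
      obtain rfl : a = y := by simpa using ha
      exact mono _ _ (fun _ h => h.elim) _ h
    -- Two premises at most means that one binary union, with `y` adjoined, is again a witnessing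
    -- set.
    · refine ⟨ins y (cup w₁ w₂), by simp, fun a ha => ?_⟩
      rcases mem_ins.1 ha with rfl | ha
      · refine mono _ _ ?_ _ h
        rintro x (rfl | rfl)
        exacts [by simp [hb], by simp [hc] ]
      · rcases mem_cup.1 ha with ha | ha
        · exact mono _ _ (fun x hx => by simp [hx]) _ (h₁ a ha)
        · exact mono _ _ (fun x hx => by simp [hx]) _ (h₂ a ha)

end Witness

noncomputable section

/-! ### Coded syntax as predicates on the model. -/

section Codes

variable {M : Type} [Lin.Structure M] [hM : M ⊨ KPomega] {n : ℕ} {v : Fin n → M}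

/-- The code of the variable with index `i`. -/
abbrev varc (i : M) : M := tag 0 i

/-- The code of the constant for `x`. -/
abbrev cst (x : M) : M := tag 1 x

/-- The code of `⊥`. -/
abbrev botc : M := tag 0 emp

/-- The code of `s = t`. -/
abbrev eqc (s t : M) : M := tag 1 (pr s t)

/-- The code of `s ∈ t`. -/
abbrev memc (s t : M) : M := tag 2 (pr s t)

/-- The code of `a → b`. -/
abbrev impc (a b : M) : M := tag 3 (pr a b)

/-- The code of `∀ v a`. -/
abbrev allc (v a : M) : M := tag 4 (pr v a)

/-- `y` is a variable. -/
def IsVar (y : M) : Prop := ∃ i, IsNat i ∧ y = varc i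

/-- `y` is a term. -/
def IsTerm (y : M) : Prop := IsVar y ∨ ∃ x, y = cst x

@[simp] theorem sat_isVar {y : Fin n} : Sat (isVar y) v ↔ IsVar (v y) := by
  simp [isVar, IsVar]

@[simp] theorem sat_isConstOf {x y : Fin n} : Sat (isConstOf x y) v ↔ v y = cst (v x) := by
  simp [isConstOf]

@[simp] theorem sat_isTerm {y : Fin n} : Sat (isTerm y) v ↔ IsTerm (v y) := by
  simp [isTerm, IsTerm]

@[simp] theorem sat_isBot {y : Fin n} : Sat (isBot y) v ↔ v y = botc := by
  simp [isBot]

@[simp] theorem sat_isEq {s t y : Fin n} : Sat (isEq s t y) v ↔ v y = eqc (v s) (v t) := by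
  simp [isEq]

@[simp] theorem sat_isMem {s t y : Fin n} : Sat (isMem s t y) v ↔ v y = memc (v s) (v t) := by
  simp [isMem]

@[simp] theorem sat_isImp {s t y : Fin n} : Sat (isImp s t y) v ↔ v y = impc (v s) (v t) := by
  simp [isImp]

@[simp] theorem sat_isAll {s t y : Fin n} : Sat (isAll s t y) v ↔ v y = allc (v s) (v t) := by
  simp [isAll]

/-- The clauses for formulas with terms in `Q`. -/
def FormClause (Q : M → Prop) (S : M → Prop) (a : M) : Prop :=
  ((a = botc ∨ ∃ s t, (Q s ∧ Q t) ∧ (a = eqc s t ∨ a = memc s t)) ∨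
    ∃ b, S b ∧ ∃ c, S c ∧ a = impc b c) ∨ ∃ u b, S b ∧ IsVar u ∧ a = allc u b

/-- `y` is a formula with terms in `Q`. -/
def FormOver (Q : M → Prop) (y : M) : Prop := Wit (FormClause Q) y

theorem formOver_iff {Q : M → Prop} {y : M} : FormOver Q y ↔ FormClause Q (FormOver Q) y := by
  refine wit_iff ?_ ?_ y
  · rintro S S' h a ((ha | ⟨b, hb, c, hc, rfl⟩) | ⟨u, b, hb, hu, rfl⟩)
    exacts [.inl (.inl ha), .inl (.inr ⟨b, h _ hb, c, h _ hc, rfl⟩),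
      .inr ⟨u, b, h _ hb, hu, rfl⟩]
  · rintro S a ((ha | ⟨b, hb, c, hc, rfl⟩) | ⟨u, b, hb, hu, rfl⟩)
    exacts [.inl (.inl (.inl ha)),
      .inr ⟨b, c, hb, hc, .inl (.inr ⟨b, .inl rfl, c, .inr rfl, rfl⟩)⟩,
      .inr ⟨b, b, hb, hb, .inr ⟨u, b, .inl rfl, hu, rfl⟩⟩]

/-- `y` is a formula of `L_∞`. -/
def Form (y : M) : Prop := FormOver IsTerm y

/-- `y` is a formula without constants. -/
def FormIn (y : M) : Prop := FormOver IsVar y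

theorem sat_isFormOver {P : ∀ {m : ℕ}, Fin m → F m} {Q : M → Prop}
    (h : ∀ {m : ℕ} {v : Fin m → M} {x : Fin m}, Sat (P x) v ↔ Q (v x)) {y : Fin n} :
    Sat (isFormOver P y) v ↔ FormOver Q (v y) := by
  simp [isFormOver, FormOver, Wit, FormClause, h]

@[simp] theorem sat_isForm {y : Fin n} : Sat (isForm y) v ↔ Form (v y) :=
  sat_isFormOver sat_isTerm

@[simp] theorem sat_isFormIn {y : Fin n} : Sat (isFormIn y) v ↔ FormIn (v y) :=
  sat_isFormOver sat_isVar

/-- The clauses for formulas in which `u` is not free. -/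
def NotFreeClause (u : M) (S : M → Prop) (b : M) : Prop :=
  ((b = botc ∨ ∃ s t, (s ≠ u ∧ t ≠ u) ∧ (b = eqc s t ∨ b = memc s t)) ∨
    ∃ c, S c ∧ ∃ d, S d ∧ b = impc c d) ∨ ∃ z c, b = allc z c ∧ (z = u ∨ S c)

/-- The variable `u` is not free in `a`. -/
def NotFree (u a : M) : Prop := Wit (NotFreeClause u) a

@[simp] theorem sat_notFree {u a : Fin n} : Sat (notFree u a) v ↔ NotFree (v u) (v a) := by
  simp [notFree, NotFree, Wit, NotFreeClause]

theorem notFree_iff {u y : M} : NotFree u y ↔ NotFreeClause u (NotFree u) y := by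
  refine wit_iff ?_ ?_ y
  · rintro S S' h a ((ha | ⟨b, hb, c, hc, rfl⟩) | ⟨u, b, rfl, hb⟩)
    exacts [.inl (.inl ha), .inl (.inr ⟨b, h _ hb, c, h _ hc, rfl⟩),
      .inr ⟨u, b, rfl, hb.imp_right (h _)⟩]
  · rintro S a ((ha | ⟨b, hb, c, hc, rfl⟩) | ⟨u, b, rfl, hb | hb⟩)
    exacts [.inl (.inl (.inl ha)),
      .inr ⟨b, c, hb, hc, .inl (.inr ⟨b, .inl rfl, c, .inr rfl, rfl⟩)⟩,
      .inl (.inr ⟨u, b, rfl, .inl hb⟩),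
      .inr ⟨b, b, hb, hb, .inr ⟨u, b, rfl, .inr (.inl rfl)⟩⟩]

/-- `s'` is the result of substituting `t` for `u` in the term `s`. -/
def SubstTerm (u t s s' : M) : Prop := (s = u ∧ s' = t) ∨ (s ≠ u ∧ s' = s)

omit hM in
@[simp] theorem sat_substTerm {u t s s' : Fin n} :
    Sat (substTerm u t s s') v ↔ SubstTerm (v u) (v t) (v s) (v s') := by
  simp [substTerm, SubstTerm]

/-- The clauses for pairs of atomic formulas with related terms, and for implications of related
formulas. -/
def PairClause (R S : M → M → Prop) (c d : M) : Prop :=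
  ((c = botc ∧ d = botc) ∨ ∃ s r s' r', (R s s' ∧ R r r') ∧
    ((c = eqc s r ∧ d = eqc s' r') ∨ (c = memc s r ∧ d = memc s' r'))) ∨
  ∃ c₁ c₂ d₁ d₂, ((c = impc c₁ c₂ ∧ d = impc d₁ d₂) ∧ S c₁ d₁) ∧ S c₂ d₂

theorem PairClause.mono {R S S' : M → M → Prop} (h : ∀ x y, S x y → S' x y) {c d : M}
    (hc : PairClause R S c d) : PairClause R S' c d := by
  rcases hc with h' | ⟨c₁, c₂, d₁, d₂, ⟨hc, h₁⟩, h₂⟩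
  exacts [.inl h', .inr ⟨c₁, c₂, d₁, d₂, ⟨hc, h _ _ h₁⟩, h _ _ h₂⟩]

/-- An implication consults two pairs and an atomic clause none, as `wit_iff` requires. -/
theorem PairClause.fin {R : M → M → Prop} {S : M → Prop} {c d : M}
    (h : PairClause R (fun x y => S (pr x y)) c d) :
    PairClause R (fun _ _ => False) c d ∨ ∃ p q, S p ∧ S q ∧
      PairClause R (fun x y => pr x y = p ∨ pr x y = q) c d := by
  rcases h with h | ⟨c₁, c₂, d₁, d₂, ⟨h, h₁⟩, h₂⟩
  exacts [.inl (.inl h), .inr ⟨_, _, h₁, h₂, .inr ⟨c₁, c₂, d₁, d₂, ⟨h, .inl rfl⟩, .inr rfl⟩⟩]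

/-- The clauses for the graph of substitution. -/
def SubstClause (u t : M) (S : M → M → Prop) (c d : M) : Prop :=
  (PairClause (SubstTerm u t) S c d ∨ ∃ c₁, c = allc u c₁ ∧ d = c) ∨
  ∃ z c₁ d₁, (((z ≠ u ∧ c = allc z c₁) ∧ d = allc z d₁) ∧ S c₁ d₁) ∧ (z ≠ t ∨ NotFree u c₁)

/-- `t` is free for `u` in `a`, and `b` is the result of substituting `t` for `u` in `a`. -/
def Subst (u t a b : M) : Prop :=
  Wit (fun S p => ∃ c d, p = pr c d ∧ SubstClause u t (fun x y => S (pr x y)) c d) (pr a b)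

@[simp] theorem sat_isSubst {u t a b : Fin n} :
    Sat (isSubst u t a b) v ↔ Subst (v u) (v t) (v a) (v b) := by
  simp [isSubst, Subst, Wit, SubstClause, PairClause]

theorem subst_iff {u t a b : M} : Subst u t a b ↔ SubstClause u t (Subst u t) a b := by
  refine (wit_iff ?_ ?_ (pr a b)).trans ?_
  · rintro S S' h a ⟨c, d, rfl, (h' | h') | ⟨z, c₁, d₁, ⟨hz, h₁⟩, h₂⟩⟩
    exacts [⟨c, d, rfl, .inl (.inl (h'.mono fun _ _ => h _))⟩, ⟨c, d, rfl, .inl (.inr h')⟩,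
      ⟨c, d, rfl, .inr ⟨z, c₁, d₁, ⟨hz, h _ h₁⟩, h₂⟩⟩]
  · rintro S a ⟨c, d, rfl, (h' | h') | ⟨z, c₁, d₁, ⟨hz, h₁⟩, h₂⟩⟩
    · rcases h'.fin with h' | ⟨p, q, hp, hq, h'⟩
      exacts [.inl ⟨c, d, rfl, .inl (.inl h')⟩, .inr ⟨p, q, hp, hq, c, d, rfl, .inl (.inl h')⟩]
    · exact .inl ⟨c, d, rfl, .inl (.inr h')⟩
    · exact .inr ⟨_, _, h₁, h₁, c, d, rfl, .inr ⟨z, c₁, d₁, ⟨hz, .inl rfl⟩, h₂⟩⟩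
  · simp only [pr_inj]
    constructor
    · rintro ⟨c, d, ⟨rfl, rfl⟩, h⟩
      exact h
    · exact fun h => ⟨a, b, ⟨rfl, rfl⟩, h⟩

/-! ### Replacing a constant by a fresh variable -/

/-- `s'` is the term `s`, other than `u`, with `k` replaced by `u`. -/
def ReplTerm (k u s s' : M) : Prop :=
  (IsTerm s ∧ IsTerm s') ∧ ((s = k ∧ s' = u) ∨ ((s ≠ k ∧ s ≠ u) ∧ s' = s))

/-- The clauses for the graph of replacement. -/
def ReplClause (k u : M) (S : M → M → Prop) (c d : M) : Prop :=
  PairClause (ReplTerm k u) S c d ∨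
  ∃ z c₁ d₁, ((((z ≠ u ∧ IsVar z) ∧ c = allc z c₁) ∧ d = allc z d₁) ∧ S c₁ d₁)

/-- `u` does not occur in the formula `a`, and `b` is the result of replacing `k` by `u` in `a`. -/
def Repl (k u a b : M) : Prop :=
  Wit (fun S p => ∃ c d, p = pr c d ∧ ReplClause k u (fun x y => S (pr x y)) c d) (pr a b)

/-- The formula expressing `Repl`. -/
def isRepl {n : ℕ} (k u a b : Fin n) : F n :=
  exF fun w => pairMem (a : Fin _) b w ⊓ ballF w fun p => exF fun c => exF fun d =>
    isPair (c : Fin _) d p ⊓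
    (((isBot (c : Fin _) ⊓ isBot d) ⊔
    (exF fun s => exF fun r => exF fun s' => exF fun r' =>
      ((isTerm (s : Fin _) ⊓ isTerm (s' : Fin _)) ⊓ ((eqF (s : Fin _) k ⊓ eqF (s' : Fin _) u) ⊔
        ((∼(eqF (s : Fin _) k) ⊓ ∼(eqF (s : Fin _) u)) ⊓ eqF (s' : Fin _) s)) ⊓
      ((isTerm (r : Fin _) ⊓ isTerm (r' : Fin _)) ⊓ ((eqF (r : Fin _) k ⊓ eqF (r' : Fin _) u) ⊔
        ((∼(eqF (r : Fin _) k) ⊓ ∼(eqF (r : Fin _) u)) ⊓ eqF (r' : Fin _) r)))) ⊓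
      ((isEq (s : Fin _) r c ⊓ isEq (s' : Fin _) r' d) ⊔
        (isMem (s : Fin _) r c ⊓ isMem (s' : Fin _) r' d))) ⊔
    (exF fun c₁ => exF fun c₂ => exF fun d₁ => exF fun d₂ =>
      isImp (c₁ : Fin _) c₂ c ⊓ isImp (d₁ : Fin _) d₂ d ⊓
      pairMem (c₁ : Fin _) d₁ w ⊓ pairMem (c₂ : Fin _) d₂ w)) ⊔
    (exF fun z => exF fun c₁ => exF fun d₁ =>
      ∼(eqF (z : Fin _) u) ⊓ isVar (z : Fin _) ⊓ isAll (z : Fin _) c₁ c ⊓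
      isAll (z : Fin _) d₁ d ⊓ pairMem (c₁ : Fin _) d₁ w))

@[simp] theorem sat_isRepl {k u a b : Fin n} :
    Sat (isRepl k u a b) v ↔ Repl (v k) (v u) (v a) (v b) := by
  simp [isRepl, Repl, Wit, ReplClause, PairClause, ReplTerm]

theorem repl_iff {k u a b : M} : Repl k u a b ↔ ReplClause k u (Repl k u) a b := by
  refine (wit_iff ?_ ?_ (pr a b)).trans ?_
  · rintro S S' h a ⟨c, d, rfl, h' | ⟨z, c₁, d₁, hz, h₁⟩⟩
    exacts [⟨c, d, rfl, .inl (h'.mono fun _ _ => h _)⟩, ⟨c, d, rfl, .inr ⟨z, c₁, d₁, hz, h _ h₁⟩⟩]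
  · rintro S a ⟨c, d, rfl, h' | ⟨z, c₁, d₁, hz, h₁⟩⟩
    · rcases h'.fin with h' | ⟨p, q, hp, hq, h'⟩
      exacts [.inl ⟨c, d, rfl, .inl h'⟩, .inr ⟨p, q, hp, hq, c, d, rfl, .inl h'⟩]
    · exact .inr ⟨_, _, h₁, h₁, c, d, rfl, .inr ⟨z, c₁, d₁, hz, .inl rfl⟩⟩
  · simp only [pr_inj]
    constructor
    · rintro ⟨c, d, ⟨rfl, rfl⟩, h⟩
      exact h
    · exact fun h => ⟨a, b, ⟨rfl, rfl⟩, h⟩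

end Codes

end


/-! ### Substitution and replacement on codes. -/

section CodeLemmas

variable {M : Type} [Lin.Structure M] [hM : M ⊨ KPomega]

/-! ### Inversion -/

@[simp] theorem formOver_botc {Q : M → Prop} : FormOver Q botc := by
  rw [formOver_iff]; simp [FormClause]

@[simp] theorem formOver_eqc {Q : M → Prop} {s t : M} : FormOver Q (eqc s t) ↔ Q s ∧ Q t := by
  rw [formOver_iff]; simp [FormClause]

@[simp] theorem formOver_memc {Q : M → Prop} {s t : M} : FormOver Q (memc s t) ↔ Q s ∧ Q t := by
  rw [formOver_iff]; simp [FormClause]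

@[simp] theorem formOver_impc {Q : M → Prop} {a b : M} :
    FormOver Q (impc a b) ↔ FormOver Q a ∧ FormOver Q b := by
  rw [formOver_iff]; simp [FormClause]

@[simp] theorem formOver_allc {Q : M → Prop} {z a : M} :
    FormOver Q (allc z a) ↔ IsVar z ∧ FormOver Q a := by
  rw [formOver_iff]; simp [FormClause, and_comm]

@[simp] theorem form_botc : Form (botc : M) := formOver_botc
@[simp] theorem form_eqc {s t : M} : Form (eqc s t) ↔ IsTerm s ∧ IsTerm t := formOver_eqc
@[simp] theorem form_memc {s t : M} : Form (memc s t) ↔ IsTerm s ∧ IsTerm t := formOver_memc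
@[simp] theorem form_impc {a b : M} : Form (impc a b) ↔ Form a ∧ Form b := formOver_impc
@[simp] theorem form_allc {z a : M} : Form (allc z a) ↔ IsVar z ∧ Form a := formOver_allc
@[simp] theorem formIn_eqc {s t : M} : FormIn (eqc s t) ↔ IsVar s ∧ IsVar t := formOver_eqc
@[simp] theorem formIn_memc {s t : M} : FormIn (memc s t) ↔ IsVar s ∧ IsVar t := formOver_memc
@[simp] theorem formIn_impc {a b : M} : FormIn (impc a b) ↔ FormIn a ∧ FormIn b := formOver_impc
@[simp] theorem formIn_allc {z a : M} : FormIn (allc z a) ↔ IsVar z ∧ FormIn a := formOver_allc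

@[simp] theorem notFree_botc {u : M} : NotFree u botc := by
  rw [notFree_iff]; simp [NotFreeClause]

@[simp] theorem notFree_eqc {u s t : M} : NotFree u (eqc s t) ↔ s ≠ u ∧ t ≠ u := by
  rw [notFree_iff]; simp [NotFreeClause]

@[simp] theorem notFree_memc {u s t : M} : NotFree u (memc s t) ↔ s ≠ u ∧ t ≠ u := by
  rw [notFree_iff]; simp [NotFreeClause]

@[simp] theorem notFree_impc {u a b : M} :
    NotFree u (impc a b) ↔ NotFree u a ∧ NotFree u b := by
  rw [notFree_iff]; simp [NotFreeClause]

@[simp] theorem notFree_allc {u z a : M} : NotFree u (allc z a) ↔ z = u ∨ NotFree u a := by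
  rw [notFree_iff]; simp [NotFreeClause]

theorem subst_botc {u t b : M} : Subst u t botc b ↔ b = botc := by
  rw [subst_iff]; simp [SubstClause, PairClause]

theorem subst_eqc {u t s r b : M} : Subst u t (eqc s r) b ↔
    ∃ s' r', (SubstTerm u t s s' ∧ SubstTerm u t r r') ∧ b = eqc s' r' := by
  rw [subst_iff]; simp [SubstClause, PairClause]

theorem subst_memc {u t s r b : M} : Subst u t (memc s r) b ↔
    ∃ s' r', (SubstTerm u t s s' ∧ SubstTerm u t r r') ∧ b = memc s' r' := by
  rw [subst_iff]; simp [SubstClause, PairClause]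

theorem subst_impc {u t a₁ a₂ b : M} : Subst u t (impc a₁ a₂) b ↔
    ∃ b₁ b₂, (Subst u t a₁ b₁ ∧ Subst u t a₂ b₂) ∧ b = impc b₁ b₂ := by
  rw [subst_iff]; simp [SubstClause, PairClause]
  grind

theorem subst_allc {u t z a b : M} : Subst u t (allc z a) b ↔
    (z = u ∧ b = allc z a) ∨
      (z ≠ u ∧ (z ≠ t ∨ NotFree u a) ∧ ∃ b₁, Subst u t a b₁ ∧ b = allc z b₁) := by
  rw [subst_iff]; simp [SubstClause, PairClause]
  grind

theorem repl_botc {k u b : M} : Repl k u botc b ↔ b = botc := by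
  rw [repl_iff]; simp [ReplClause, PairClause]

theorem repl_eqc {k u s r b : M} : Repl k u (eqc s r) b ↔
    ∃ s' r', (ReplTerm k u s s' ∧ ReplTerm k u r r') ∧ b = eqc s' r' := by
  rw [repl_iff]; simp [ReplClause, PairClause]

theorem repl_memc {k u s r b : M} : Repl k u (memc s r) b ↔
    ∃ s' r', (ReplTerm k u s s' ∧ ReplTerm k u r r') ∧ b = memc s' r' := by
  rw [repl_iff]; simp [ReplClause, PairClause]

theorem repl_impc {k u a₁ a₂ b : M} : Repl k u (impc a₁ a₂) b ↔
    ∃ b₁ b₂, (Repl k u a₁ b₁ ∧ Repl k u a₂ b₂) ∧ b = impc b₁ b₂ := by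
  rw [repl_iff]; simp [ReplClause, PairClause]
  grind

theorem repl_allc {k u z a b : M} : Repl k u (allc z a) b ↔
    (z ≠ u ∧ IsVar z) ∧ ∃ b₁, Repl k u a b₁ ∧ b = allc z b₁ := by
  rw [repl_iff]; simp [ReplClause, PairClause]
  grind

/-! ### Induction -/

/-- Code induction is applied to the implication `Form a → P a`, so only that implication has to be
definable and codes that are not formulas cause no trouble. -/
theorem Form.induction {P : M → Prop} (hP : Dfn fun a => Form a → P a)
    (bot : P botc) (eq : ∀ s t, IsTerm s → IsTerm t → P (eqc s t))
    (mem : ∀ s t, IsTerm s → IsTerm t → P (memc s t)) (imp : ∀ a b, P a → P b → P (impc a b))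
    (all : ∀ z a, IsVar z → Form a → P a → P (allc z a)) {a : M} (h : Form a) : P a := by
  refine code_induction hP (fun x ih hx => ?_) a h
  rcases formOver_iff.1 hx with
    ((rfl | ⟨s, t, ⟨hs, ht⟩, rfl | rfl⟩) | ⟨b, hb, c, hc, rfl⟩) | ⟨u, b, hb, hu, rfl⟩
  · exact bot
  · exact eq s t hs ht
  · exact mem s t hs ht
  · exact imp _ _ ((ih _ _ _ rfl).1 hb) ((ih _ _ _ rfl).2 hc)
  · exact all _ _ hu hb ((ih _ _ _ rfl).2 hb)

theorem Repl.induction {k u : M} {P : M → M → Prop}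
    (hP : Dfn fun a => ∀ b, Repl k u a b → P a b) (bot : P botc botc)
    (eq : ∀ s t s' t', ReplTerm k u s s' → ReplTerm k u t t' → P (eqc s t) (eqc s' t'))
    (mem : ∀ s t s' t', ReplTerm k u s s' → ReplTerm k u t t' → P (memc s t) (memc s' t'))
    (imp : ∀ a b a' b', P a a' → P b b' → P (impc a b) (impc a' b'))
    (all : ∀ z a a', z ≠ u → IsVar z → Repl k u a a' → P a a' → P (allc z a) (allc z a')) {a b : M}
    (h : Repl k u a b) : P a b := by
  refine code_induction hP (fun x ih y hx => ?_) a b h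
  rcases repl_iff.1 hx with
    ((⟨rfl, rfl⟩ | ⟨s, t, s', t', ⟨hs, ht⟩, ⟨rfl, rfl⟩ | ⟨rfl, rfl⟩⟩) |
      ⟨b, c, b', c', ⟨⟨rfl, rfl⟩, hb⟩, hc⟩) | ⟨z, b, b', ⟨⟨⟨hz, hv⟩, rfl⟩, rfl⟩, hb⟩
  · exact bot
  · exact eq _ _ _ _ hs ht
  · exact mem _ _ _ _ hs ht
  · exact imp _ _ _ _ ((ih _ _ _ rfl).1 _ hb) ((ih _ _ _ rfl).2 _ hc)
  · exact all _ _ _ hz hv hb ((ih _ _ _ rfl).2 _ hb)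

/-! ### Properties of replacement -/

theorem ReplTerm.unique {k u s s' s'' : M} (h : ReplTerm k u s s') (h' : ReplTerm k u s s'') :
    s' = s'' := by
  unfold ReplTerm at h h'
  grind

theorem Repl.unique {k u a b b' : M} (h : Repl k u a b) (h' : Repl k u a b') : b = b' := by
  refine Repl.induction (P := fun a b => ∀ b', Repl k u a b' → b = b') (.of ![k, u]
    (fun i a => allF fun b => isRepl (i 0 : Fin _) (i 1 : Fin _) (a : Fin _) b ⟹ allF fun b' =>
      isRepl (i 0 : Fin _) (i 1 : Fin _) (a : Fin _) b' ⟹ eqF (b : Fin _) b')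
    fun n v i x h => by simp [h]) ?_ ?_ ?_ ?_ ?_ h _ h'
  · intro b' h
    exact (repl_botc.1 h).symm
  · intro s t s' t' hs ht b' h
    obtain ⟨s'', t'', ⟨hs', ht'⟩, rfl⟩ := repl_eqc.1 h
    rw [hs.unique hs', ht.unique ht']
  · intro s t s' t' hs ht b' h
    obtain ⟨s'', t'', ⟨hs', ht'⟩, rfl⟩ := repl_memc.1 h
    rw [hs.unique hs', ht.unique ht']
  · intro a b a' b' iha ihb c h
    obtain ⟨a'', b'', ⟨ha, hb⟩, rfl⟩ := repl_impc.1 h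
    rw [iha _ ha, ihb _ hb]
  · intro z a a' _ _ _ iha c h
    obtain ⟨-, a'', ha, rfl⟩ := repl_allc.1 h
    rw [iha _ ha]

/-- This is what the conditions `IsTerm` and `IsVar` in the replacement clauses are for: a replaced
axiom must again be built from genuine formulas. -/
theorem Repl.form {k u a b : M} (h : Repl k u a b) : Form a ∧ Form b := by
  refine Repl.induction (P := fun a b => Form a ∧ Form b) (.of ![k, u]
    (fun i a => allF fun b => isRepl (i 0 : Fin _) (i 1 : Fin _) (a : Fin _) b ⟹
      (isForm (a : Fin _) ⊓ isForm b)) fun n v i x h => by simp [h]) ?_ ?_ ?_ ?_ ?_ h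
  · simp
  · rintro s t s' t' hs ht
    simp [hs.1, ht.1]
  · rintro s t s' t' hs ht
    simp [hs.1, ht.1]
  · simp +contextual
  · simp +contextual

/-- Variables carry tag 0 and constants tag 1, so no term of a constant-free formula is replaced.
Here the absence of constants from the axioms of `τ` enters. -/
theorem Repl.eq_of_formIn {x u a b : M} (h : Repl (cst x) u a b) (ha : FormIn a) : b = a := by
  revert ha
  have hs : ∀ {s s' : M}, ReplTerm (cst x) u s s' → IsVar s → s' = s := by
    rintro s s' ⟨-, ⟨rfl, -⟩ | ⟨-, rfl⟩⟩ ⟨i, -, hi⟩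
    · simp at hi
    · rfl
  refine Repl.induction (P := fun a b => FormIn a → b = a) (.of ![cst x, u]
    (fun i a => allF fun b => isRepl (i 0 : Fin _) (i 1 : Fin _) (a : Fin _) b ⟹
      (isFormIn (a : Fin _) ⟹ eqF b a)) fun n v i x h => by simp [h]) ?_ ?_ ?_ ?_ ?_ h
  · simp
  · intro s t s' t' h1 h2 h
    rw [formIn_eqc] at h
    rw [hs h1 h.1, hs h2 h.2]
  · intro s t s' t' h1 h2 h
    rw [formIn_memc] at h
    rw [hs h1 h.1, hs h2 h.2]
  · intro a b a' b' iha ihb h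
    rw [formIn_impc] at h
    rw [iha h.1, ihb h.2]
  · intro z a a' _ _ _ iha h
    rw [formIn_allc] at h
    rw [iha h.2]

theorem NotFree.repl {k u y a b : M} (ha : NotFree y a) (h : Repl k u a b) (hy : y ≠ u) :
    NotFree y b := by
  revert ha
  have hs : ∀ {s s' : M}, ReplTerm k u s s' → s ≠ y → s' ≠ y := by
    rintro s s' ⟨-, ⟨rfl, rfl⟩ | ⟨-, rfl⟩⟩ h
    exacts [hy.symm, h]
  refine Repl.induction (P := fun a b => NotFree y a → NotFree y b) (.of ![k, u, y]
    (fun i a => allF fun b => isRepl (i 0 : Fin _) (i 1 : Fin _) (a : Fin _) b ⟹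
      (notFree (i 2 : Fin _) (a : Fin _) ⟹ notFree (i 2 : Fin _) b))
    fun n v i x h => by simp [h]) ?_ ?_ ?_ ?_ ?_ h
  · simp
  · intro s t s' t' h1 h2 h
    rw [notFree_eqc] at h ⊢
    exact ⟨hs h1 h.1, hs h2 h.2⟩
  · intro s t s' t' h1 h2 h
    rw [notFree_memc] at h ⊢
    exact ⟨hs h1 h.1, hs h2 h.2⟩
  · intro a b a' b' iha ihb h
    rw [notFree_impc] at h ⊢
    exact ⟨iha h.1, ihb h.2⟩
  · intro z a a' _ _ _ iha h
    rw [notFree_allc] at h ⊢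
    exact h.imp_right iha

/-- Replacement commutes with substitution. The bound variables of `a` differ from `u` because `a`
has a replacement, so `u` is free for `y` when it takes the place of the constant. In the other case
`t` may even be `u`; then `y` cannot be free in `a`, since otherwise `u` would occur in `b`. -/
theorem Subst.repl {x u y t t' a a' b b' : M} (h : Subst y t a b) (ha : Repl (cst x) u a a')
    (hb : Repl (cst x) u b b') (hy : IsVar y) (hyu : y ≠ u)
    (ht : (t = cst x ∧ t' = u) ∨ (t ≠ cst x ∧ t' = t)) : Subst y t' a' b' := by
  have hyx : y ≠ cst x := by
    rintro rfl
    obtain ⟨i, -, hi⟩ := hy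
    simp at hi
  have hs : ∀ {s r s' r' : M}, ReplTerm (cst x) u s s' → ReplTerm (cst x) u r r' →
      SubstTerm y t s r → SubstTerm y t' s' r' := by
    intro s r s' r' h1 h2 h3
    unfold ReplTerm at h1 h2
    unfold SubstTerm at h3 ⊢
    grind
  refine Repl.induction (P := fun a a' => ∀ b b', Subst y t a b → Repl (cst x) u b b' →
    Subst y t' a' b') (.of ![cst x, u, y, t, t']
    (fun i a => allF fun a' => isRepl (i 0 : Fin _) (i 1 : Fin _) (a : Fin _) a' ⟹
      allF fun b => allF fun b' => isSubst (i 2 : Fin _) (i 3 : Fin _) (a : Fin _) b ⟹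
        isRepl (i 0 : Fin _) (i 1 : Fin _) (b : Fin _) b' ⟹
        isSubst (i 2 : Fin _) (i 4 : Fin _) (a' : Fin _) b')
    fun n v i x h => by simp [h]) ?_ ?_ ?_ ?_ ?_ ha _ _ h hb
  · intro b b' h hb
    obtain rfl := subst_botc.1 h
    exact subst_botc.2 (repl_botc.1 hb)
  · intro s r s' r' h1 h2 b b' h hb
    obtain ⟨s₁, r₁, ⟨hs₁, hr₁⟩, rfl⟩ := subst_eqc.1 h
    obtain ⟨s₂, r₂, ⟨hs₂, hr₂⟩, rfl⟩ := repl_eqc.1 hb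
    exact subst_eqc.2 ⟨_, _, ⟨hs h1 hs₂ hs₁, hs h2 hr₂ hr₁⟩, rfl⟩
  · intro s r s' r' h1 h2 b b' h hb
    obtain ⟨s₁, r₁, ⟨hs₁, hr₁⟩, rfl⟩ := subst_memc.1 h
    obtain ⟨s₂, r₂, ⟨hs₂, hr₂⟩, rfl⟩ := repl_memc.1 hb
    exact subst_memc.2 ⟨_, _, ⟨hs h1 hs₂ hs₁, hs h2 hr₂ hr₁⟩, rfl⟩
  · intro a₁ a₂ a₁' a₂' ih₁ ih₂ b b' h hb
    obtain ⟨b₁, b₂, ⟨h₁, h₂⟩, rfl⟩ := subst_impc.1 h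
    obtain ⟨b₁', b₂', ⟨hb₁, hb₂⟩, rfl⟩ := repl_impc.1 hb
    exact subst_impc.2 ⟨_, _, ⟨ih₁ _ _ h₁ hb₁, ih₂ _ _ h₂ hb₂⟩, rfl⟩
  · intro z a₁ a₁' hz _ ha₁ ih b b' h hb
    rcases subst_allc.1 h with ⟨rfl, rfl⟩ | ⟨hzy, hzt, b₁, hb₁, rfl⟩
    · obtain ⟨-, b₁', hb₁, rfl⟩ := repl_allc.1 hb
      exact subst_allc.2 (.inl ⟨rfl, by rw [hb₁.unique ha₁]⟩)
    · obtain ⟨-, b₁', hb₁', rfl⟩ := repl_allc.1 hb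
      refine subst_allc.2 (.inr ⟨hzy, ?_, _, ih _ _ hb₁ hb₁', rfl⟩)
      refine hzt.imp (fun hzt => ?_) fun hn => hn.repl ha₁ hyu
      rcases ht with ⟨-, rfl⟩ | ⟨-, rfl⟩
      exacts [hz, hzt]

theorem Subst.form {u t a b : M} (h : Subst u t a b) (ha : Form a) (ht : IsTerm t) : Form b := by
  have hs : ∀ {s s' : M}, SubstTerm u t s s' → IsTerm s → IsTerm s' := by
    rintro s s' (⟨-, rfl⟩ | ⟨-, rfl⟩) h
    exacts [ht, h]
  refine Form.induction (P := fun a => ∀ b, Subst u t a b → Form b) (.of ![u, t]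
    (fun i a => isForm a ⟹ allF fun b => isSubst (i 0 : Fin _) (i 1 : Fin _) (a : Fin _) b ⟹
      isForm b) fun n v i x h => by simp [h]) ?_ ?_ ?_ ?_ ?_ ha _ h
  · intro b h
    rw [subst_botc.1 h]
    exact form_botc
  · intro s r h₁ h₂ b h
    obtain ⟨s₁, r₁, ⟨hs₁, hr₁⟩, rfl⟩ := subst_eqc.1 h
    exact form_eqc.2 ⟨hs hs₁ h₁, hs hr₁ h₂⟩
  · intro s r h₁ h₂ b h
    obtain ⟨s₁, r₁, ⟨hs₁, hr₁⟩, rfl⟩ := subst_memc.1 h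
    exact form_memc.2 ⟨hs hs₁ h₁, hs hr₁ h₂⟩
  · intro a₁ a₂ ih₁ ih₂ b h
    obtain ⟨b₁, b₂, ⟨h₁, h₂⟩, rfl⟩ := subst_impc.1 h
    exact form_impc.2 ⟨ih₁ _ h₁, ih₂ _ h₂⟩
  · intro z a₁ hz ha₁ ih b h
    rcases subst_allc.1 h with ⟨rfl, rfl⟩ | ⟨hzy, hzt, b₁, hb₁, rfl⟩
    · exact form_allc.2 ⟨hz, ha₁⟩
    · exact form_allc.2 ⟨hz, ih _ hb₁⟩

/-- A threshold of `i + 1` works for the variable with index `i`, and `0` for a constant. Asking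
that all larger indices be fresh allows the thresholds of several parts to be merged by a maximum.
-/
theorem IsTerm.exists_repl {x s : M} (h : IsTerm s) : ∃ n, IsNat n ∧ ∀ m, IsNat m → Le n m →
    ∃ s', ReplTerm (cst x) (varc m) s s' := by
  rcases h with ⟨i, hi, rfl⟩ | ⟨y, rfl⟩
  · have hv : IsTerm (varc i) := .inl ⟨i, hi, rfl⟩
    refine ⟨suc i, hi.suc, fun m hm hl => ⟨varc i, ⟨hv, hv⟩, .inr ⟨⟨by simp, ?_⟩, rfl⟩⟩⟩
    have him : i ε m := by
      rcases hl with hl | rfl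
      exacts [hm.trans hl (by simp), by simp]
    intro h
    obtain rfl : i = m := by simpa using h
    exact not_mem_self _ him
  · refine ⟨emp, isNat_emp, fun m hm _ => ?_⟩
    have hy : IsTerm (cst y) := .inr ⟨y, rfl⟩
    by_cases h : y = x
    · exact ⟨varc m, ⟨hy, .inl ⟨m, hm, rfl⟩⟩, .inl ⟨by rw [h], rfl⟩⟩
    · exact ⟨cst y, ⟨hy, hy⟩, .inr ⟨⟨by simpa using h, by simp⟩, rfl⟩⟩

theorem Form.exists_repl {x a : M} (h : Form a) : ∃ n, IsNat n ∧ ∀ m, IsNat m → Le n m →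
    ∃ b, Repl (cst x) (varc m) a b := by
  refine Form.induction (P := fun a => ∃ n, IsNat n ∧ ∀ m, IsNat m → Le n m →
    ∃ b, Repl (cst x) (varc m) a b) (.of ![cst x] (fun i a => isForm a ⟹ exF fun n => isNat n ⊓
      allF fun m => isNat m ⟹ (memF (n : Fin _) m ⊔ eqF (n : Fin _) m) ⟹ exF fun b => exF fun u =>
        isTagged 0 (m : Fin _) u ⊓ isRepl (i 0 : Fin _) u (a : Fin _) (b : Fin _))
    fun n v i x h => by simp [h, Le]) ?_ ?_ ?_ ?_ ?_ h
  · exact ⟨emp, isNat_emp, fun m _ _ => ⟨botc, repl_botc.2 rfl⟩⟩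
  · intro s t hs ht
    obtain ⟨n₁, hn₁, h₁⟩ := hs.exists_repl (x := x)
    obtain ⟨n₂, hn₂, h₂⟩ := ht.exists_repl (x := x)
    obtain ⟨n, hn, hmax⟩ := exists_max hn₁ hn₂
    refine ⟨n, hn, fun m hm hl => ?_⟩
    obtain ⟨s', hs'⟩ := h₁ m hm (hmax m hm hl).1
    obtain ⟨t', ht'⟩ := h₂ m hm (hmax m hm hl).2
    exact ⟨_, repl_eqc.2 ⟨_, _, ⟨hs', ht'⟩, rfl⟩⟩
  · intro s t hs ht
    obtain ⟨n₁, hn₁, h₁⟩ := hs.exists_repl (x := x)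
    obtain ⟨n₂, hn₂, h₂⟩ := ht.exists_repl (x := x)
    obtain ⟨n, hn, hmax⟩ := exists_max hn₁ hn₂
    refine ⟨n, hn, fun m hm hl => ?_⟩
    obtain ⟨s', hs'⟩ := h₁ m hm (hmax m hm hl).1
    obtain ⟨t', ht'⟩ := h₂ m hm (hmax m hm hl).2
    exact ⟨_, repl_memc.2 ⟨_, _, ⟨hs', ht'⟩, rfl⟩⟩
  · rintro a b ⟨n₁, hn₁, h₁⟩ ⟨n₂, hn₂, h₂⟩
    obtain ⟨n, hn, hmax⟩ := exists_max hn₁ hn₂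
    refine ⟨n, hn, fun m hm hl => ?_⟩
    obtain ⟨a', ha'⟩ := h₁ m hm (hmax m hm hl).1
    obtain ⟨b', hb'⟩ := h₂ m hm (hmax m hm hl).2
    exact ⟨_, repl_impc.2 ⟨_, _, ⟨ha', hb'⟩, rfl⟩⟩
  · rintro z a hz - ⟨n₁, hn₁, h₁⟩
    -- The bound variable is treated as one more term; that it has a replacement says that it
    -- differs from the fresh variable.
    obtain ⟨n₂, hn₂, h₂⟩ := (IsTerm.exists_repl (x := x) (.inl hz))
    obtain ⟨n, hn, hmax⟩ := exists_max hn₁ hn₂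
    refine ⟨n, hn, fun m hm hl => ?_⟩
    obtain ⟨a', ha'⟩ := h₁ m hm (hmax m hm hl).1
    obtain ⟨z', hz'⟩ := h₂ m hm (hmax m hm hl).2
    refine ⟨_, repl_allc.2 ⟨⟨?_, hz⟩, _, ha', rfl⟩⟩
    obtain ⟨i, -, rfl⟩ := hz
    rcases hz'.2 with ⟨h, -⟩ | ⟨⟨-, h⟩, -⟩
    exacts [by simp at h, h]

end CodeLemmas


/-! ### Logical axioms and derivations under replacement. -/

section Logic

variable {M : Type} [Lin.Structure M] [hM : M ⊨ KPomega] {n : ℕ} {v : Fin n → M}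

/-- `y` is an instance of an axiom scheme of `L_∞`. -/
def LogicalAxiom (y : M) : Prop :=
  ((((((∃ a b, (Form a ∧ Form b) ∧ y = impc a (impc b a)) ∨
    (∃ a b c, ((Form a ∧ Form b) ∧ Form c) ∧
      y = impc (impc a (impc b c)) (impc (impc a b) (impc a c)))) ∨
    (∃ a, Form a ∧ y = impc (impc (impc a botc) botc) a)) ∨
    (∃ u t a b, (((IsVar u ∧ IsTerm t) ∧ Form a) ∧ Subst u t a b) ∧ y = impc (allc u a) b)) ∨
    (∃ u a b, (((IsVar u ∧ Form a) ∧ Form b) ∧ NotFree u a) ∧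
      y = impc (allc u (impc a b)) (impc a (allc u b)))) ∨
    (∃ t, IsTerm t ∧ y = eqc t t)) ∨
    (∃ s t u a b, (((IsTerm s ∧ IsTerm t) ∧ IsTerm u) ∧
      (((a = eqc s u ∧ b = eqc t u) ∨ (a = memc s u ∧ b = memc t u)) ∨
        (a = memc u s ∧ b = memc u t))) ∧ y = impc (eqc s t) (impc a b))

theorem sat_axK {y : Fin n} : Sat (axK y) v ↔
    ∃ a b, (Form a ∧ Form b) ∧ v y = impc a (impc b a) := by
  simp [axK]

theorem sat_axS {y : Fin n} : Sat (axS y) v ↔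
    ∃ a b c, ((Form a ∧ Form b) ∧ Form c) ∧
      v y = impc (impc a (impc b c)) (impc (impc a b) (impc a c)) := by
  simp [axS]

theorem sat_axDN {y : Fin n} : Sat (axDN y) v ↔
    ∃ a, Form a ∧ v y = impc (impc (impc a botc) botc) a := by
  simp [axDN]

theorem sat_axInst {y : Fin n} : Sat (axInst y) v ↔
    ∃ u t a b, (((IsVar u ∧ IsTerm t) ∧ Form a) ∧ Subst u t a b) ∧
      v y = impc (allc u a) b := by
  simp [axInst]

theorem sat_axDist {y : Fin n} : Sat (axDist y) v ↔
    ∃ u a b, (((IsVar u ∧ Form a) ∧ Form b) ∧ NotFree u a) ∧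
      v y = impc (allc u (impc a b)) (impc a (allc u b)) := by
  simp [axDist]

theorem sat_axRefl {y : Fin n} : Sat (axRefl y) v ↔ ∃ t, IsTerm t ∧ v y = eqc t t := by
  simp [axRefl]

theorem sat_axLeib {y : Fin n} : Sat (axLeib y) v ↔
    ∃ s t u a b, (((IsTerm s ∧ IsTerm t) ∧ IsTerm u) ∧
      (((a = eqc s u ∧ b = eqc t u) ∨ (a = memc s u ∧ b = memc t u)) ∨
        (a = memc u s ∧ b = memc u t))) ∧ v y = impc (eqc s t) (impc a b) := by
  simp [axLeib]

@[simp] theorem sat_isLogicalAxiom {y : Fin n} :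
    Sat (isLogicalAxiom y) v ↔ LogicalAxiom (v y) := by
  simp only [isLogicalAxiom, LogicalAxiom, sat_or, sat_axK, sat_axS, sat_axDN, sat_axInst,
    sat_axDist, sat_axRefl, sat_axLeib]

theorem FormIn.form {a : M} (h : FormIn a) : Form a := by
  obtain ⟨w, ha, hw⟩ := h
  refine ⟨w, ha, fun b hb => ?_⟩
  rcases hw b hb with ((h | ⟨s, t, ⟨hs, ht⟩, h⟩) | h) | h
  exacts [.inl (.inl (.inl h)), .inl (.inl (.inr ⟨s, t, ⟨.inl hs, .inl ht⟩, h⟩)), .inl (.inr h),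
    .inr h]

theorem LogicalAxiom.form {y : M} (h : LogicalAxiom y) : Form y := by
  rcases h with (((((⟨a, b, ⟨ha, hb⟩, rfl⟩ | ⟨a, b, c, ⟨⟨ha, hb⟩, hc⟩, rfl⟩) | ⟨a, ha, rfl⟩) |
    ⟨u, t, a, b, ⟨⟨⟨hu, ht⟩, ha⟩, hs⟩, rfl⟩) | ⟨u, a, b, ⟨⟨⟨hu, ha⟩, hb⟩, hn⟩, rfl⟩) | ⟨t, ht, rfl⟩) |
    ⟨s, t, u, a, b, ⟨⟨⟨hs, ht⟩, hu⟩, h⟩, rfl⟩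
  · simp [*]
  · simp [*]
  · simp [*]
  · simp [*, hs.form ha ht]
  · simp [*]
  · simp [*]
  · rcases h with (⟨rfl, rfl⟩ | ⟨rfl, rfl⟩) | ⟨rfl, rfl⟩ <;> simp [*]

/-- Each scheme is closed under replacement: uniqueness of replacement identifies the images of
repeated subformulas, and the side conditions survive by `Subst.repl` and `NotFree.repl`. -/
theorem LogicalAxiom.repl {x u y y' : M} (h : LogicalAxiom y) (hu : IsVar u)
    (hr : Repl (cst x) u y y') : LogicalAxiom y' := by
  rcases h with (((((⟨a, b, ⟨ha, hb⟩, rfl⟩ | ⟨a, b, c, ⟨⟨ha, hb⟩, hc⟩, rfl⟩) | ⟨a, ha, rfl⟩) |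
    ⟨z, t, a, b, ⟨⟨⟨hz, ht⟩, ha⟩, hs⟩, rfl⟩) | ⟨z, a, b, ⟨⟨⟨hz, ha⟩, hb⟩, hn⟩, rfl⟩) | ⟨t, ht, rfl⟩) |
    ⟨s, t, r, a, b, ⟨⟨⟨hs, ht⟩, hr'⟩, h⟩, rfl⟩
  · simp only [repl_impc] at hr
    obtain ⟨a', _, ⟨ha', b', a'', ⟨hb', ha''⟩, rfl⟩, rfl⟩ := hr
    obtain rfl := ha'.unique ha''
    exact .inl (.inl (.inl (.inl (.inl (.inl ⟨_, _, ⟨ha'.form.2, hb'.form.2⟩, rfl⟩)))))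
  · simp only [repl_impc] at hr
    obtain ⟨_, _, ⟨⟨a₁, _, ⟨ha₁, b₁, c₁, ⟨hb₁, hc₁⟩, rfl⟩, rfl⟩,
      ⟨_, _, ⟨⟨a₂, b₂, ⟨ha₂, hb₂⟩, rfl⟩, ⟨a₃, c₂, ⟨ha₃, hc₂⟩, rfl⟩⟩, rfl⟩⟩, rfl⟩ := hr
    obtain rfl := ha₁.unique ha₂
    obtain rfl := ha₁.unique ha₃
    obtain rfl := hb₁.unique hb₂
    obtain rfl := hc₁.unique hc₂
    exact .inl (.inl (.inl (.inl (.inl (.inr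
      ⟨_, _, _, ⟨⟨ha₁.form.2, hb₁.form.2⟩, hc₁.form.2⟩, rfl⟩)))))
  · simp only [repl_impc, repl_botc] at hr
    obtain ⟨_, a₁, ⟨⟨_, _, ⟨⟨a₂, _, ⟨ha₂, rfl⟩, rfl⟩, rfl⟩, rfl⟩, ha₁⟩, rfl⟩ := hr
    obtain rfl := ha₁.unique ha₂
    exact .inl (.inl (.inl (.inl (.inr ⟨_, ha₁.form.2, rfl⟩))))
  · simp only [repl_impc, repl_allc] at hr
    obtain ⟨_, b', ⟨⟨⟨hzu, -⟩, a', ha', rfl⟩, hb'⟩, rfl⟩ := hr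
    refine .inl (.inl (.inl (.inr ?_)))
    -- If the instantiating term is the replaced constant, the new axiom instantiates with `u`
    -- instead.
    by_cases htx : t = cst x
    · exact ⟨z, u, a', b', ⟨⟨⟨hz, .inl hu⟩, ha'.form.2⟩,
        hs.repl ha' hb' hz hzu (.inl ⟨htx, rfl⟩)⟩, rfl⟩
    · exact ⟨z, t, a', b', ⟨⟨⟨hz, ht⟩, ha'.form.2⟩,
        hs.repl ha' hb' hz hzu (.inr ⟨htx, rfl⟩)⟩, rfl⟩
  · simp only [repl_impc, repl_allc] at hr
    obtain ⟨_, _, ⟨⟨⟨hzu, -⟩, _, ⟨a₁, b₁, ⟨ha₁, hb₁⟩, rfl⟩, rfl⟩,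
      ⟨a₂, _, ⟨ha₂, -, b₂, hb₂, rfl⟩, rfl⟩⟩, rfl⟩ := hr
    obtain rfl := ha₁.unique ha₂
    obtain rfl := hb₁.unique hb₂
    exact .inl (.inl (.inr ⟨z, a₁, b₁, ⟨⟨⟨hz, ha₁.form.2⟩, hb₁.form.2⟩, hn.repl ha₁ hzu⟩, rfl⟩))
  · obtain ⟨t₁, t₂, ⟨h₁, h₂⟩, rfl⟩ := repl_eqc.1 hr
    obtain rfl := h₁.unique h₂
    exact .inl (.inr ⟨t₁, h₁.1.2, rfl⟩)
  · rcases h with (⟨rfl, rfl⟩ | ⟨rfl, rfl⟩) | ⟨rfl, rfl⟩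
    all_goals
      simp only [repl_impc, repl_eqc, repl_memc] at hr
      obtain ⟨_, _, ⟨⟨s₁, t₁, ⟨hs₁, ht₁⟩, rfl⟩, ⟨_, _, ⟨⟨p₁, p₂, ⟨hp₁, hp₂⟩, rfl⟩,
        ⟨q₁, q₂, ⟨hq₁, hq₂⟩, rfl⟩⟩, rfl⟩⟩, rfl⟩ := hr
    · obtain rfl := hs₁.unique hp₁
      obtain rfl := ht₁.unique hq₁
      obtain rfl := hp₂.unique hq₂
      exact .inr ⟨_, _, _, _, _, ⟨⟨⟨hs₁.1.2, ht₁.1.2⟩, hp₂.1.2⟩, .inl (.inl ⟨rfl, rfl⟩)⟩, rfl⟩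
    · obtain rfl := hs₁.unique hp₁
      obtain rfl := ht₁.unique hq₁
      obtain rfl := hp₂.unique hq₂
      exact .inr ⟨_, _, _, _, _, ⟨⟨⟨hs₁.1.2, ht₁.1.2⟩, hp₂.1.2⟩, .inl (.inr ⟨rfl, rfl⟩)⟩, rfl⟩
    · obtain rfl := hs₁.unique hp₂
      obtain rfl := ht₁.unique hq₂
      obtain rfl := hp₁.unique hq₁
      exact .inr ⟨_, _, _, _, _, ⟨⟨⟨hs₁.1.2, ht₁.1.2⟩, hp₁.1.2⟩, .inr ⟨rfl, rfl⟩⟩, rfl⟩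

/-! ### Derivations -/

/-- `f` is a function with domain `m`. -/
def FunOn (f m : M) : Prop :=
  ((∀ p, p ε f → ∃ i, i ε m ∧ ∃ a, p = pr i a) ∧ ∀ i, i ε m → ∃ a, pr i a ε f) ∧
    ∀ i, i ε m → ∀ a b, pr i a ε f → pr i b ε f → a = b

@[simp] theorem sat_isFunOn {f m : Fin n} : Sat (isFunOn f m) v ↔ FunOn (v f) (v m) := by
  simp [isFunOn, FunOn]

/-- `a` may stand as line `i` of the derivation `f` from the axioms in `A`. -/
def Line (A : M → Prop) (f i a : M) : Prop :=
  ((LogicalAxiom a ∨ A a) ∨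
    ∃ j, j ε i ∧ ∃ k, k ε i ∧ ∃ b c, (pr j b ε f ∧ pr k c ε f) ∧ c = impc b a) ∨
  ∃ j, j ε i ∧ ∃ z b, (pr j b ε f ∧ IsVar z) ∧ a = allc z b

@[simp] theorem sat_isLine {τ : F 1} {f i a : Fin n} :
    Sat (isLine τ f i a) v ↔ Line (fun y => Sat τ ![y]) (v f) (v i) (v a) := by
  have (v : Fin n → M) : (v ∘ ![a]) = ![v a] := by ext i; fin_cases i; rfl
  simp [isLine, Line, this]

/-- `f` is a derivation of length `m` from the axioms in `A`. -/
def Deriv (A : M → Prop) (f m : M) : Prop :=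
  FunOn f m ∧ ∀ i, i ε m → ∀ a, pr i a ε f → Line A f i a

/-- `y` is derivable from the axioms in `A`. -/
def Provable (A : M → Prop) (y : M) : Prop :=
  ∃ f l, IsNat l ∧ Deriv A f (suc l) ∧ pr l y ε f

theorem sat_isProvable {τ : F 1} {y : Fin n} :
    Sat (isProvable τ y) v ↔ Provable (fun x => Sat τ ![x]) (v y) := by
  simp [isProvable, isProof, Provable, Deriv, -mem_suc, and_assoc]

theorem nat_induction {P : M → Prop} (hP : Dfn fun x => IsNat x → P x) (zero : P emp)
    (succ : ∀ x, IsNat x → P x → P (suc x)) (x : M) (hx : IsNat x) : P x := by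
  refine mem_induction hP (fun x ih hx => ?_) x hx
  rcases hx.1.2 with rfl | ⟨y, rfl⟩
  · exact zero
  · exact succ y (hx.of_mem (by simp)) (ih y (by simp) (hx.of_mem (by simp)))

theorem Le.mem_of_suc {x m : M} (hm : IsNat m) (h : Le (suc x) m) : x ε m := by
  rcases h with h | rfl
  exacts [hm.trans h (by simp), by simp]

theorem funOn_emp : FunOn (emp : M) emp := by
  simp [FunOn]

theorem FunOn.ins {f m : M} (h : FunOn f m) (a : M) : FunOn (ins (pr m a) f) (suc m) := by
  obtain ⟨⟨h1, h2⟩, h3⟩ := h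
  have hm : ∀ b, ¬ pr m b ε f := fun b hb => by
    obtain ⟨i, hi, c, hc⟩ := h1 _ hb
    rw [pr_inj] at hc
    exact not_mem_self m (hc.1 ▸ hi)
  refine ⟨⟨fun p hp => ?_, fun i hi => ?_⟩, fun i hi b c hb hc => ?_⟩
  · rcases mem_ins.1 hp with rfl | hp
    · exact ⟨m, by simp, a, rfl⟩
    · obtain ⟨i, hi, b, rfl⟩ := h1 p hp
      exact ⟨i, by simp [hi], b, rfl⟩
  · rcases mem_suc.1 hi with hi | rfl
    · obtain ⟨b, hb⟩ := h2 i hi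
      exact ⟨b, by simp [hb]⟩
    · exact ⟨a, by simp⟩
  · rcases mem_suc.1 hi with hi | rfl
    · have him : i ≠ m := fun h => not_mem_self m (h ▸ hi)
      simp [him] at hb hc
      exact h3 i hi b c hb hc
    · simp [hm] at hb hc
      rw [hb, hc]

theorem Line.mono {A : M → Prop} {f g i a : M} (h : ∀ p, p ε f → p ε g) (hl : Line A f i a) :
    Line A g i a := by
  rcases hl with (hl | ⟨j, hj, k, hk, b, c, ⟨hb, hc⟩, rfl⟩) | ⟨j, hj, z, b, ⟨hb, hz⟩, rfl⟩
  exacts [.inl (.inl hl), .inl (.inr ⟨j, hj, k, hk, b, _, ⟨h _ hb, h _ hc⟩, rfl⟩),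
    .inr ⟨j, hj, z, b, ⟨h _ hb, hz⟩, rfl⟩]

theorem Deriv.ins {A : M → Prop} {f m a : M} (h : Deriv A f m) (ha : Line A f m a) :
    Deriv A (ins (pr m a) f) (suc m) := by
  refine ⟨h.1.ins a, fun i hi b hb => Line.mono (f := f) (fun p hp => by simp [hp]) ?_⟩
  rcases mem_ins.1 hb with hb' | hb'
  · obtain ⟨rfl, rfl⟩ := pr_inj.1 hb'
    exact ha
  · rcases mem_suc.1 hi with hi | rfl
    · exact h.2 i hi b hb'
    · obtain ⟨j, hj, c, hc⟩ := h.1.1.1 _ hb'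
      exact (not_mem_self j ((pr_inj.1 hc).1 ▸ hj)).elim

theorem Deriv.form {A : M → Prop} (hA : ∀ y, A y → FormIn y) {f m : M} (hm : IsNat m)
    (h : Deriv A f m) (i : M) : i ε m → ∀ a, pr i a ε f → Form a := by
  refine mem_induction (P := fun i => i ε m → ∀ a, pr i a ε f → Form a)
    (.of ![m, f] (fun i x => memF x (i 0) ⟹ allF fun a =>
    pairMem (x : Fin _) a (i 1 : Fin _) ⟹ isForm a) fun n v i x h => by simp [h]) ?_ i
  intro i ih hi a ha
  rcases h.2 i hi a ha with
    ((hl | hl) | ⟨j, hj, k, hk, b, c, ⟨hb, hc⟩, rfl⟩) | ⟨j, hj, z, b, ⟨hb, hz⟩, rfl⟩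
  · exact hl.form
  · exact (hA _ hl).form
  · exact (form_impc.1 (ih k hk (hm.trans hi hk) _ hc)).2
  · exact form_allc.2 ⟨hz, ih j hj (hm.trans hi hj) _ hb⟩

/-- An induction inside the model along the length of `f`, taking at each new line the maximum of
the old threshold and that of the line. -/
theorem Deriv.exists_fresh {A : M → Prop} (hA : ∀ y, A y → FormIn y) {f m : M} (hm : IsNat m)
    (h : Deriv A f m) (x : M) : ∃ k, IsNat k ∧ ∀ i, i ε m → ∀ a, pr i a ε f →
      ∃ b, Repl (cst x) (varc k) a b := by
  have key : ∀ j, IsNat j → Le j m → ∃ n, IsNat n ∧ ∀ k, IsNat k → Le n k → ∀ i, i ε j →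
      ∀ a, pr i a ε f → ∃ b, Repl (cst x) (varc k) a b := by
    refine nat_induction (.of ![m, f, cst x] (fun i j => isNat j ⟹ (memF j (i 0) ⊔ eqF j (i 0)) ⟹
      exF fun n => isNat n ⊓ allF fun k => isNat k ⟹ (memF (n : Fin _) k ⊔ eqF (n : Fin _) k) ⟹
        allF fun l => memF l (j : Fin _) ⟹ allF fun a => pairMem (l : Fin _) a (i 1 : Fin _) ⟹
          exF fun b => exF fun u => isTagged 0 (k : Fin _) u ⊓
            isRepl (i 2 : Fin _) u (a : Fin _) (b : Fin _)) fun n v i x h => by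
              simp [h, Le]) ?_ ?_
    · exact fun _ => ⟨emp, isNat_emp, by simp⟩
    · intro j hj ih hjm
      have hjm' := hjm.mem_of_suc hm
      obtain ⟨n₁, hn₁, h₁⟩ := ih (.inl hjm')
      obtain ⟨a, ha⟩ := h.1.1.2 j hjm'
      obtain ⟨n₂, hn₂, h₂⟩ := (h.form hA hm j hjm' a ha).exists_repl (x := x)
      obtain ⟨n, hn, hmax⟩ := exists_max hn₁ hn₂
      refine ⟨n, hn, fun k hk hnk i hi b hb => ?_⟩
      rcases mem_suc.1 hi with hi | rfl
      · exact h₁ k hk (hmax k hk hnk).1 i hi b hb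
      · obtain rfl := h.1.2 _ hjm' _ _ ha hb
        exact h₂ k hk (hmax k hk hnk).2
  obtain ⟨n, hn, hn'⟩ := key m hm (.inr rfl)
  exact ⟨n, hn, hn' n hn (.inr rfl)⟩

/-- The sequence of replaced lines is built by adjoining one pair at a time. Afterwards each line is
justified by the rule that justified the original, since uniqueness of replacement matches the
premises. -/
theorem Deriv.exists_repl {A : M → Prop} (hA : ∀ y, A y → FormIn y) {f m x u : M} (hm : IsNat m)
    (h : Deriv A f m) (hu : IsVar u)
    (hr : ∀ i, i ε m → ∀ a, pr i a ε f → ∃ b, Repl (cst x) u a b) :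
    ∃ g, Deriv A g m ∧
      ∀ i, i ε m → ∀ a b, pr i a ε f → pr i b ε g → Repl (cst x) u a b := by
  have key : ∀ j, IsNat j → Le j m → ∃ g, FunOn g j ∧
      ∀ i, i ε j → ∀ a b, pr i a ε f → pr i b ε g → Repl (cst x) u a b := by
    refine nat_induction (.of ![m, f, cst x, u] (fun i j => isNat j ⟹
      (memF j (i 0) ⊔ eqF j (i 0)) ⟹ exF fun g => isFunOn g (j : Fin _) ⊓ allF fun l =>
        memF l (j : Fin _) ⟹ allF fun a => allF fun b => pairMem (l : Fin _) a (i 1 : Fin _) ⟹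
          pairMem (l : Fin _) b (g : Fin _) ⟹ isRepl (i 2 : Fin _) (i 3 : Fin _) (a : Fin _) b)
      fun n v i x h => by simp [h, Le]) ?_ ?_
    · exact fun _ => ⟨emp, funOn_emp, by simp⟩
    · intro j hj ih hjm
      have hjm' := hjm.mem_of_suc hm
      obtain ⟨g, hg, hg'⟩ := ih (.inl hjm')
      obtain ⟨a, ha⟩ := h.1.1.2 j hjm'
      obtain ⟨b, hb⟩ := hr j hjm' a ha
      refine ⟨_, hg.ins b, fun i hi c d hc hd => ?_⟩
      rcases mem_suc.1 hi with hi | rfl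
      · have hij : i ≠ j := fun h => not_mem_self j (h ▸ hi)
        simp [hij] at hd
        exact hg' i hi c d hc hd
      · obtain rfl := h.1.2 _ hjm' _ _ ha hc
        obtain rfl : d = b := (hg.ins b).2 i (by simp) _ _ hd (by simp)
        exact hb
  obtain ⟨g, hg, hg'⟩ := key m hm (.inr rfl)
  refine ⟨g, ⟨hg, fun i hi b hb => ?_⟩, hg'⟩
  obtain ⟨a, ha⟩ := h.1.1.2 i hi
  have hab := hg' i hi a b ha hb
  rcases h.2 i hi a ha with
    ((hl | hl) | ⟨j, hj, k, hk, c, _, ⟨hc, hd⟩, rfl⟩) | ⟨j, hj, z, c, ⟨hc, hz⟩, rfl⟩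
  · exact .inl (.inl (.inl (hl.repl hu hab)))
  · rw [hab.eq_of_formIn (hA _ hl)]
    exact .inl (.inl (.inr hl))
  · obtain ⟨c', hc'⟩ := hg.1.2 j (hm.trans hi hj)
    obtain ⟨d', hd'⟩ := hg.1.2 k (hm.trans hi hk)
    have hcc := hg' j (hm.trans hi hj) _ _ hc hc'
    have hdd := hg' k (hm.trans hi hk) _ _ hd hd'
    obtain ⟨c'', b', ⟨h₁, h₂⟩, rfl⟩ := repl_impc.1 hdd
    obtain rfl := hcc.unique h₁
    obtain rfl := hab.unique h₂
    exact .inl (.inr ⟨j, hj, k, hk, _, _, ⟨hc', hd'⟩, rfl⟩)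
  · obtain ⟨c', hc'⟩ := hg.1.2 j (hm.trans hi hj)
    have hcc := hg' j (hm.trans hi hj) _ _ hc hc'
    obtain ⟨-, c'', h₁, rfl⟩ := repl_allc.1 hab
    obtain rfl := hcc.unique h₁
    exact .inr ⟨j, hj, z, _, ⟨hc', hz⟩, rfl⟩

end Logic


noncomputable section

/-! ### Codes of actual formulas, and reflection. -/

section Codes

variable {M : Type} [Lin.Structure M] [hM : M ⊨ KPomega]

/-- The code of a term, where `s i` is the code of the variable `&i`. -/
def termCode {k : ℕ} (s : ℕ → M) : Lin.Term (Empty ⊕ Fin k) → M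
  | Term.var (Sum.inr i) => s i
  | Term.var (Sum.inl z) => z.elim
  | Term.func g _ => Empty.elim g

/-- The code of a formula, where `s i` is the code of the free variable `&i`. -/
def code : ∀ {k : ℕ}, F k → (ℕ → M) → M
  | _, BoundedFormula.falsum, _ => botc
  | _, BoundedFormula.equal t₁ t₂, s => eqc (termCode s t₁) (termCode s t₂)
  | _, BoundedFormula.rel MemRel.mem ts, s => memc (termCode s (ts 0)) (termCode s (ts 1))
  | _, BoundedFormula.imp φ ψ, s => impc (code φ s) (code ψ s)
  | k, BoundedFormula.all φ, s => allc (varc (num k)) (code φ s)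

/-- The codes of the variables under an assignment of constants to some of them. -/
def codeVar {n : ℕ} (e : ℕ → Option (Fin n)) (v : Fin n → M) (i : ℕ) : M :=
  match e i with
  | some x => cst (v x)
  | none => varc (num i)

@[simp] theorem codeVar_wk {n : ℕ} (e : ℕ → Option (Fin n)) (v : Fin n → M) (x : M) :
    codeVar (wk e) (Fin.snoc v x) = codeVar e v := by
  funext i
  unfold codeVar wk
  cases e i <;> simp

@[simp] theorem sat_isTermCode {k n : ℕ} {v : Fin n → M} {e : ℕ → Option (Fin n)}
    {t : Lin.Term (Empty ⊕ Fin k)} {y : Fin n} :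
    Sat (isTermCode e t y) v ↔ v y = termCode (codeVar e v) t := by
  rcases t with (z | i) | ⟨g, -⟩
  · exact z.elim
  · simp only [isTermCode, termCode, codeVar]
    cases h : e i <;> simp
  · exact g.elim

theorem sat_isCode {k : ℕ} (φ : F k) : ∀ {n : ℕ} {v : Fin n → M} {e : ℕ → Option (Fin n)}
    {y : Fin n}, Sat (isCode φ e y) v ↔ v y = code φ (codeVar e v) := by
  induction φ with
  | falsum => simp [isCode, code]
  | equal t₁ t₂ => simp [isCode, code]
  | rel R ts =>
    cases R
    intros
    simp [isCode, code]
  | imp φ ψ ih₁ ih₂ => simp [isCode, code, ih₁, ih₂]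
  | all φ ih => simp [isCode, code, ih]

/-- The codes of the variables when the first `k` of them are replaced by constants. -/
def constVar {k : ℕ} (v : Fin k → M) (i : ℕ) : M :=
  if h : i < k then cst (v ⟨i, h⟩) else varc (num i)

theorem sat_ofCode {P : ∀ {m : ℕ}, Fin m → F m} {Q : M → Prop}
    (h : ∀ {m : ℕ} {v : Fin m → M} {x : Fin m}, Sat (P x) v ↔ Q (v x)) {k : ℕ} {φ : F k}
    {v : Fin k → M} : Sat (ofCode P φ) v ↔ Q (code φ (constVar v)) := by
  have e (x : M) : codeVar (fun i => if h : i < k then some (Fin.castSucc ⟨i, h⟩) else none)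
      (Fin.snoc v x : Fin (k + 1) → M) = constVar v := by
    funext i
    unfold codeVar constVar
    by_cases h : i < k
    · simp only [h, dif_pos]
      rw [Fin.snoc_castSucc]
    · simp only [h, dif_neg, not_false_eq_true]
  simp only [ofCode, sat_exF, sat_and, sat_isCode, h, e, Fin.snoc_last, exists_eq_left]

theorem sat_Prov {τ : F 1} {k : ℕ} {φ : F k} {v : Fin k → M} :
    Sat (Prov τ φ) v ↔ Provable (fun x => Sat τ ![x]) (code φ (constVar v)) :=
  sat_ofCode sat_isProvable

/-- That a replacement exists is a hypothesis, so freshness of `u` for the code need not be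
computed; it only remains to identify the result. -/
theorem repl_code {x u : M} {s s' : ℕ → M}
    (hs : ∀ i r, ReplTerm (cst x) u (s i) r → r = s' i) {k : ℕ} (φ : F k) :
    ∀ b, Repl (cst x) u (code φ s) b → b = code φ s' := by
  have ht : ∀ {k : ℕ} (t : Lin.Term (Empty ⊕ Fin k)) r, ReplTerm (cst x) u (termCode s t) r →
      r = termCode s' t := by
    rintro k ((z | i) | ⟨g, -⟩) r h
    exacts [z.elim, hs _ _ h, g.elim]
  induction φ with
  | falsum => exact fun b h => repl_botc.1 h
  | equal t₁ t₂ =>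
    intro b h
    obtain ⟨r₁, r₂, ⟨h₁, h₂⟩, rfl⟩ := repl_eqc.1 h
    rw [ht _ _ h₁, ht _ _ h₂, code]
  | rel R ts =>
    cases R
    intro b h
    obtain ⟨r₁, r₂, ⟨h₁, h₂⟩, rfl⟩ := repl_memc.1 h
    rw [ht _ _ h₁, ht _ _ h₂, code]
  | imp φ ψ ih₁ ih₂ =>
    intro b h
    obtain ⟨b₁, b₂, ⟨h₁, h₂⟩, rfl⟩ := repl_impc.1 h
    rw [ih₁ _ h₁, ih₂ _ h₂, code]
  | all φ ih =>
    intro b h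
    obtain ⟨-, b₁, h₁, rfl⟩ := repl_allc.1 h
    rw [ih _ h₁, code]

/-- The replacement `b` serves only as a certificate that `u` is no bound variable of `φ`. As `0 <
k`, the bound variables have positive index, so `v₀` is free for `u`. -/
theorem subst_code {x u : M} {s s' s'' : ℕ → M}
    (hs : ∀ i r, ReplTerm (cst x) u (s i) r → SubstTerm u (varc (num 0)) (s' i) (s'' i))
    {k : ℕ} (φ : F k) (hk : 0 < k) : ∀ b, Repl (cst x) u (code φ s) b →
      Subst u (varc (num 0)) (code φ s') (code φ s'') := by
  have ht : ∀ {k : ℕ} (t : Lin.Term (Empty ⊕ Fin k)) r, ReplTerm (cst x) u (termCode s t) r →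
      SubstTerm u (varc (num 0)) (termCode s' t) (termCode s'' t) := by
    rintro k ((z | i) | ⟨g, -⟩) r h
    exacts [z.elim, hs _ _ h, g.elim]
  induction φ with
  | falsum => exact fun b h => subst_botc.2 rfl
  | equal t₁ t₂ =>
    intro b h
    obtain ⟨r₁, r₂, ⟨h₁, h₂⟩, rfl⟩ := repl_eqc.1 h
    exact subst_eqc.2 ⟨_, _, ⟨ht _ _ h₁, ht _ _ h₂⟩, rfl⟩
  | rel R ts =>
    cases R
    intro b h
    obtain ⟨r₁, r₂, ⟨h₁, h₂⟩, rfl⟩ := repl_memc.1 h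
    exact subst_memc.2 ⟨_, _, ⟨ht _ _ h₁, ht _ _ h₂⟩, rfl⟩
  | imp φ ψ ih₁ ih₂ =>
    intro b h
    obtain ⟨b₁, b₂, ⟨h₁, h₂⟩, rfl⟩ := repl_impc.1 h
    exact subst_impc.2 ⟨_, _, ⟨ih₁ hk _ h₁, ih₂ hk _ h₂⟩, rfl⟩
  | all φ ih =>
    intro b h
    obtain ⟨⟨hu, -⟩, b₁, h₁, rfl⟩ := repl_allc.1 h
    exact subst_allc.2 (.inr ⟨hu, .inl (by simpa using hk.ne'), _, ih (by omega) _ h₁, rfl⟩)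

/-- If `φ(ẋ)` is derivable for some `x` from axioms without constants, then so is `∀ x φ`. -/
theorem Provable.all {A : M → Prop} (hA : ∀ y, A y → FormIn y) {φ : F 1} {v : Fin 1 → M}
    (h : Provable A (code φ (constVar v))) :
    Provable A (code φ.all (constVar (default : Fin 0 → M))) := by
  obtain ⟨f, l, hl, hd, hy⟩ := h
  obtain ⟨k, hk, hr⟩ := hd.exists_fresh hA hl.suc (v 0)
  have hu : IsVar (varc k) := ⟨k, hk, rfl⟩
  have h0 : IsVar (varc (num 0) : M) := ⟨num 0, isNat_emp, rfl⟩
  obtain ⟨g, hg, hg'⟩ := hd.exists_repl hA hl.suc hu hr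
  have hlm : l ε suc l := by simp
  obtain ⟨b, hb⟩ := hg.1.1.2 l hlm
  have hrb := hg' l hlm _ _ hy hb
  -- The variable `&0` is named by the fresh variable `varc k`, all others by their usual names.
  let s' : ℕ → M := fun i => if i = 0 then varc k else varc (num i)
  have hs0 : constVar v 0 = cst (v 0) := rfl
  have hs1 : ∀ i, constVar v (i + 1) = varc (num (i + 1)) := fun i => by simp [constVar]
  obtain rfl : b = code φ s' := repl_code (fun i r h => by
    rcases h with ⟨-, ⟨h, rfl⟩ | ⟨⟨h, -⟩, rfl⟩⟩
    · cases i with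
      | zero => rfl
      | succ i => simp [hs1] at h
    · cases i with
      | zero => exact (h hs0).elim
      | succ i => exact hs1 i) φ _ hrb
  have hsub : Subst (varc k) (varc (num 0)) (code φ s')
      (code φ (constVar (default : Fin 0 → M))) := subst_code (fun i r h => by
    cases i with
    | zero => exact .inl ⟨rfl, rfl⟩
    | succ i =>
      rcases h with ⟨-, ⟨h, rfl⟩ | ⟨⟨-, h⟩, rfl⟩⟩
      · simp [hs1] at h
      · rw [hs1] at h
        exact .inr ⟨h, rfl⟩) φ Nat.one_pos _ hrb
  -- Four lines are appended: `∀ u φ(u)`, the axiom `∀ u φ(u) → φ(v₀)`, then `φ(v₀)`, then `∀ v₀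
  -- φ(v₀)`. The detour through `v₀` is needed because the code of `φ.all` binds `v₀`.
  have d₁ := hg.ins (a := allc (varc k) (code φ s'))
    (.inr ⟨l, hlm, varc k, _, ⟨hb, hu⟩, rfl⟩)
  have d₂ := d₁.ins (a := impc (allc (varc k) (code φ s'))
      (code φ (constVar (default : Fin 0 → M)))) (.inl (.inl (.inl (.inl (.inl (.inl (.inr
    ⟨varc k, varc (num 0), _, _, ⟨⟨⟨hu, .inl h0⟩, hrb.form.2⟩, hsub⟩, rfl⟩)))))))
  have d₃ := d₂.ins (a := code φ (constVar (default : Fin 0 → M)))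
    (.inl (.inr ⟨suc l, by simp, suc (suc l), by simp, allc (varc k) (code φ s'), _,
      ⟨by simp, by simp⟩, rfl⟩))
  have d₄ := d₃.ins (a := allc (varc (num 0)) (code φ (constVar (default : Fin 0 → M))))
    (.inr ⟨suc (suc (suc l)), by simp, _, code φ (constVar (default : Fin 0 → M)),
      ⟨by simp, h0⟩, rfl⟩)
  exact ⟨_, _, hl.suc.suc.suc.suc, d₄, by simp [code]⟩

theorem formIn_of_constantFree {τ : F 1} (h : M ⊨ constantFree τ) (y : M) (hy : Sat τ ![y]) :
    FormIn y := by
  rw [sat_sentence] at h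
  have e : (Fin.snoc (default : Fin 0 → M) y ∘ ![Fin.last 0]) = ![y] := by
    ext i
    fin_cases i
    rfl
  simp only [constantFree, sat_allF, sat_imp, sat_app, sat_isFormIn] at h
  exact h y (by rwa [e])

theorem realize_Prov_all {τ φ : F 1} (h : M ⊨ constantFree τ) {v : Fin 1 → M}
    (hφ : Sat (Prov τ φ) v) : M ⊨ Prov τ φ.all := by
  rw [sat_sentence, sat_Prov]
  exact (sat_Prov.1 hφ).all (formIn_of_constantFree h)

/-- Local reflection is applied to the closed sentence `φ.all`, whose provability follows from that
of the single instance, and the truth of `φ.all` is then specialized. -/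
theorem realize_RFN {τ : F 1} (h : M ⊨ constantFree τ) (hR : M ⊨ Rfn τ) : M ⊨ RFN τ := by
  refine (Theory.model_iff _).2 ?_
  rintro _ ⟨k, hk, φ, rfl⟩
  refine sat_alls.2 fun v hφ => ?_
  match k, hk with
  | 0, _ =>
    rw [Subsingleton.elim v default] at hφ ⊢
    exact (Theory.model_iff _).1 hR _ ⟨φ, rfl⟩ hφ
  | 1, _ =>
    have : M ⊨ φ.all := (Theory.model_iff _).1 hR _ ⟨φ.all, rfl⟩ (realize_Prov_all h hφ)
    have hv : (Fin.snoc (default : Fin 0 → M) (v 0) : Fin 1 → M) = v := by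
      ext i
      obtain rfl : i = Fin.last 0 := Fin.ext (by omega)
      rw [Fin.snoc_last]
      rfl
    rw [← hv]
    exact sat_all.1 (sat_sentence.1 this) (v 0)

end Codes

theorem Rfn_subset_RFN (τ : F 1) : Rfn τ ⊆ RFN τ := by
  rintro _ ⟨σ, rfl⟩
  exact ⟨0, Nat.zero_le 1, σ, rfl⟩

/-- Any model of `T` is a model of `KPω`, so the coded syntax behaves well there and `constantFree
τ` is true. This covers `KPω` and `T` at once. -/
theorem proves_RFN_iff {T : Lin.Theory} {τ : F 1} (hKP : ∀ σ ∈ KPomega, Proves T σ)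
    (hconst : Proves KPomega (constantFree τ)) (ψ : Lin.Sentence) :
    Proves (T ∪ RFN τ) ψ ↔ Proves (T ∪ Rfn τ) ψ := by
  constructor
  · intro h
    refine proves_of_models fun M _ _ hT => h.sound ?_
    have hT' := Theory.model_union_iff.1 hT
    have : M ⊨ KPomega := (Theory.model_iff _).2 fun σ hσ => (hKP σ hσ).sound hT'.1
    exact Theory.model_union_iff.2 ⟨hT'.1, realize_RFN (hconst.sound this) hT'.2⟩
  · exact fun h => proves_of_models fun M _ _ hT =>
      h.sound (hT.mono (Set.union_subset_union_right _ (Rfn_subset_RFN τ)))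

end

end SetRefl

open FODeriv SetRefl in
theorem mainTheorem5 (T : Lin.Theory) (τ : F 1)
    (hKP : ∀ σ ∈ KPomega, Proves T σ)
    (hpres : ∀ σ ∈ T, Proves KPomega (axiomOf τ σ))
    (hconst : Proves KPomega (constantFree τ)) :
    (∀ φ : F 1, Proves KPomega ((Prov τ φ).all ⟹ Prov τ φ.all)) ∧
    (∀ ψ : Lin.Sentence, Proves (KPomega ∪ RFN τ) ψ ↔ Proves (KPomega ∪ Rfn τ) ψ) ∧
    (∀ ψ : Lin.Sentence, Proves (T ∪ RFN τ) ψ ↔ Proves (T ∪ Rfn τ) ψ) := by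
  refine ⟨fun φ => proves_of_models fun M _ _ hM h => ?_,
    proves_RFN_iff (fun σ hσ => .ax ⟨σ, hσ, rfl⟩) hconst, proves_RFN_iff hKP hconst⟩
  -- Only one instance of the universal premise is used, at an arbitrary element of the nonempty
  -- model.
  obtain ⟨a⟩ := ‹Nonempty M›
  have : Nonempty M := ⟨a⟩
  exact realize_Prov_all (hconst.sound hM) (sat_all.1 h a)
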